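/- All graphs are finite and simple. A path in a graph $G$ is an induced subgraph of $G$ that is a path; its interior is the path without its two ends. Two disjoint vertex sets are anticomplete if no edge of $G$ joins them. A graph is $t$-tidy if it has no clique on $t+1$ vertices and no induced minor isomorphic to $K_{t,t}$. A $q$-banana with ends $x\neq y$ is a set of $q$ pairwise internally disjoint paths in $G$ from $x$ to $y$. It is a $q$-theta if the interiors of its paths are pairwise anticomplete, and it is rigid if no two of its paths have anticomplete interiors. It is $l$-dense if the union of the vertex sets of its paths does not contain an $l$-theta with the same ends. For distinct $x,y,z$, an $(x,z)$-tailed $q$-theta is a $q$-theta $\Theta$ with ends $x,y$ together with a path $P$ in $G$ from $y$ to $z$ such that $P\setminus\{y\}$ and $V(\Theta)\setminus\{y\}$ are disjoint and anticomplete. An $(x,z)$-tailed $(k,q)$-kite is a set of $k$ $(x,z)$-tailed $q$-thetas $(\Theta_i,P_i)$, where $\Theta_i$ has ends $x,y_i$, any two of which have exactly the vertices $x$ and $z$ in common. It is clean if every vertex of $V(\Theta_i)\setminus\{x,y_i\}$ has degree two in the subgraph of $G$ induced by the vertex set of the kite, for every $i$, and $\{y_1,\dots,y_k\}$ is a stable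 set. An $(s,d)$-dome with root $x$ is a pair $(S,P)$ where $S$ is an induced subgraph of $G$ that is a subdivision of the star $K_{1,s}$ with centre $x$ and set of $s$ leaves $L$ (for $s\le 2$ this means a path of positive length with end $x$ and other end the leaf if $s=1$, or a path with $x$ in its interior and its two ends as leaves if $s=2$), $P$ is a path in $G$ disjoint from $S$, the sets $V(S)\setminus L$ and $V(P)$ are anticomplete, every vertex of $L$ has a neighbor in $P$, and every vertex of $P$ is adjacent to at most $d$ vertices of $L$. **Theorem.** There are functions $f=f(k,l,q,s,t)$ and $g=g(q,t)$ from positive integers to positive integers such that the following holds for all positive integers $k,l,q,s,t$. Let $G$ be a $t$-tidy graph that contains a rigid $l$-dense $f(k,l,q,s,t)$-banana with ends $x,z$. Then $G$ contains a clean $(x,z)$-tailed $(k,q)$-kite or an $(s,g(q,t))$-dome with root $x$. -/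

import Mathlib

namespace BananaKite

universe u v

variable {V : Type u}

/-- Two sets of vertices are anticomplete if they are disjoint and no edge joins them. -/
def Anticomplete (G : SimpleGraph V) (X Y : Set V) : Prop :=
  Disjoint X Y ∧ ∀ a ∈ X, ∀ b ∈ Y, ¬ G.Adj a b

/-- `H` is an induced minor of `G`: there are pairwise disjoint connected (hence non-empty)
branch sets in `G`, one for each vertex of `H`, such that two of them are joined by an edge of `G`
exactly when the corresponding vertices of `H` are adjacent. -/
def HasInducedMinor {W : Type v} (G : SimpleGraph V) (H : SimpleGraph W) : Prop :=
  ∃ branch : W → Set V,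
    (∀ w, (G.induce (branch w)).Connected) ∧
    (∀ w w', w ≠ w' → Disjoint (branch w) (branch w')) ∧
    (∀ w w', w ≠ w' → ((∃ a ∈ branch w, ∃ b ∈ branch w', G.Adj a b) ↔ H.Adj w w'))

/-- `G` is `t`-tidy: it has no clique on `t + 1` vertices and no induced `K_{t,t}`-minor. -/
def IsTidy (G : SimpleGraph V) (t : ℕ) : Prop :=
  G.CliqueFree (t + 1) ∧ ¬ HasInducedMinor G (completeBipartiteGraph (Fin t) (Fin t))

/-- The walk `p` traverses a path that is an induced subgraph of `G`. -/
def IsInducedPath {G : SimpleGraph V} {a b : V} (p : G.Walk a b) : Prop :=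
  p.IsPath ∧ p.IsChordless

/-- The vertex set of a walk. -/
def walkVerts {G : SimpleGraph V} {a b : V} (p : G.Walk a b) : Set V :=
  {w | w ∈ p.support}

/-- The vertices of a walk from `a` to `b` other than `a` and `b`. -/
def pathInterior {G : SimpleGraph V} {a b : V} (p : G.Walk a b) : Set V :=
  walkVerts p \ {a, b}

/-- A `q`-banana in `G` with ends `x`, `y`: a set of `q` (distinct) pairwise internally disjoint
induced paths from `x` to `y`. -/
structure Banana (G : SimpleGraph V) (x y : V) (q : ℕ) where
  ends_ne : x ≠ y
  path : Fin q → G.Walk x y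
  isInducedPath : ∀ i, IsInducedPath (path i)
  path_injective : Function.Injective path
  internally_disjoint : ∀ i j, i ≠ j → Disjoint (pathInterior (path i)) (pathInterior (path j))

/-- The vertex set of a banana: the union of the vertex sets of its paths. -/
def Banana.verts {G : SimpleGraph V} {x y : V} {q : ℕ} (B : Banana G x y q) : Set V :=
  ⋃ i, walkVerts (B.path i)

/-- A banana is a theta if the interiors of its paths are pairwise anticomplete. -/
def Banana.IsTheta {G : SimpleGraph V} {x y : V} {q : ℕ} (B : Banana G x y q) : Prop :=
  ∀ i j, i ≠ j → Anticomplete G (pathInterior (B.path i)) (pathInterior (B.path j))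

/-- A banana is rigid if the interiors of any two of its paths are not anticomplete. -/
def Banana.IsRigid {G : SimpleGraph V} {x y : V} {q : ℕ} (B : Banana G x y q) : Prop :=
  ∀ i j, i ≠ j → ¬ Anticomplete G (pathInterior (B.path i)) (pathInterior (B.path j))

/-- A banana with ends `x`, `y` is `l`-dense if its vertex set does not contain an `l`-theta
with ends `x`, `y`. -/
def Banana.IsDense {G : SimpleGraph V} {x y : V} {q : ℕ} (B : Banana G x y q) (l : ℕ) : Prop :=
  ¬ ∃ T : Banana G x y l, T.IsTheta ∧ T.verts ⊆ B.verts

/-- An `(x,z)`-tailed `q`-theta in `G`: a `q`-theta with ends `x`, `y`, together with a tail from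
`y` to `z`. -/
structure TailedTheta (G : SimpleGraph V) (x z : V) (q : ℕ) where
  y : V
  x_ne_z : x ≠ z
  y_ne_z : y ≠ z
  theta : Banana G x y q
  isTheta : theta.IsTheta
  tail : G.Walk y z
  tail_isInducedPath : IsInducedPath tail
  tail_anticomplete : Anticomplete G (walkVerts tail \ {y}) (theta.verts \ {y})

/-- The vertex set of a tailed theta. -/
def TailedTheta.verts {G : SimpleGraph V} {x z : V} {q : ℕ} (T : TailedTheta G x z q) : Set V :=
  T.theta.verts ∪ walkVerts T.tail

/-- An `(x,z)`-tailed `(k,q)`-kite in `G`: `k` `(x,z)`-tailed `q`-thetas that pairwise meet exactly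
in `x` and `z`. -/
structure Kite (G : SimpleGraph V) (x z : V) (k q : ℕ) where
  tailedTheta : Fin k → TailedTheta G x z q
  inter_eq : ∀ i j, i ≠ j → (tailedTheta i).verts ∩ (tailedTheta j).verts = {x, z}

/-- The vertex set of a kite. -/
def Kite.verts {G : SimpleGraph V} {x z : V} {k q : ℕ} (K : Kite G x z k q) : Set V :=
  ⋃ i, (K.tailedTheta i).verts

/-- A kite is clean if every vertex of each of its thetas, other than the two ends `x`, `y i` of the
theta, has degree two in the subgraph induced by the kite, and the vertices `y i` form a
stable set. -/
def Kite.IsClean {G : SimpleGraph V} {x z : V} {k q : ℕ} (K : Kite G x z k q) : Prop :=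
  (∀ i, ∀ w ∈ (K.tailedTheta i).theta.verts \ {x, (K.tailedTheta i).y},
    (G.neighborSet w ∩ K.verts).ncard = 2) ∧
  ∀ i j, ¬ G.Adj (K.tailedTheta i).y (K.tailedTheta j).y

/-- An induced subdivision of the star `K_{1,s}` in `G` with centre `x`, given by its `s` legs: the
induced paths of positive length from `x` to the leaves, which have only `x` in common and
between which there are no further edges. For `s ≥ 3` the centre `x` is the unique vertex of degree
at least three and the leaves are the vertices of degree one. -/
structure SubdividedStar (G : SimpleGraph V) (x : V) (s : ℕ) where
  leaf : Fin s → V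
  leaf_ne : ∀ i, leaf i ≠ x
  leg : ∀ i, G.Walk x (leaf i)
  leg_isInducedPath : ∀ i, IsInducedPath (leg i)
  legs_anticomplete : ∀ i j, i ≠ j →
    Anticomplete G (walkVerts (leg i) \ {x}) (walkVerts (leg j) \ {x})

/-- The vertex set of a subdivided star. -/
def SubdividedStar.verts {G : SimpleGraph V} {x : V} {s : ℕ} (S : SubdividedStar G x s) : Set V :=
  {x} ∪ ⋃ i, walkVerts (S.leg i)

/-- The set of leaves of a subdivided star. -/
def SubdividedStar.leaves {G : SimpleGraph V} {x : V} {s : ℕ} (S : SubdividedStar G x s) : Set V :=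
  Set.range S.leaf

/-- An `(s,d)`-dome in `G` with root `x`. -/
structure Dome (G : SimpleGraph V) (x : V) (s d : ℕ) where
  star : SubdividedStar G x s
  a : V
  b : V
  path : G.Walk a b
  path_isInducedPath : IsInducedPath path
  disjoint : Disjoint star.verts (walkVerts path)
  anticomplete : Anticomplete G (star.verts \ star.leaves) (walkVerts path)
  leaf_has_neighbor : ∀ w ∈ star.leaves, ∃ p ∈ walkVerts path, G.Adj w p
  path_degree_le : ∀ p ∈ walkVerts path, (G.neighborSet p ∩ star.leaves).ncard ≤ d

end BananaKite

namespace BananaKite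

variable {V : Type*} {G : SimpleGraph V}

open SimpleGraph

/-! ### Induced paths -/

/-! The theorem holds with `g q t = t`. Its core is the alternative `exists_dome_or_hub`. Take many
pairwise anticomplete legs at `x`, all touching an induced path `p` that is anticomplete to `x`, and
cut each leg at its first vertex with a neighbor on `p`. By tidiness and Ramsey's theorem, no `t` of
the cut ends have many common neighbors on `p`. A counting argument (`exists_spread_or_last`) then
leaves two cases. Either `s` of the ends are spread over a final segment of `p`, each vertex of
which sees at most `t` of them, and this is a dome. Or many ends have the same last neighbor `y` on
`p`, a hub: their legs form a theta from `x` to `y`, and the part of `p` after `y` is anticomplete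
to it.

The legs and the path come from `exists_comb_bound`: if all elements of a large stable set touch a
connected set `H`, then `H` contains an induced path from a prescribed vertex to which many pairwise
anticomplete connected sets, each containing an element of the stable set, are attached. The stable
set consists of neighbors of `x` on the banana, `H` is the rest of the banana without `x`, and the
path is read towards `z`. A hub `y ≠ z` yields a tailed theta inside the banana; the hub `z` would
yield an `l`-theta, which density excludes (`exists_dome_or_tailedTheta`).

A large banana splits into many groups of paths, all still `l`-dense, so without a dome it contains
many tailed thetas that meet only in `x` and `z`. Three kinds of edges between them have to be
avoided. Edges between the vertices `y` disappear by Ramsey's theorem. If many paths of one theta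
touched the same many tails, choosing hubs on one tail after another would give a dome or an induced
`K_{t,t}`-minor (`exists_dome_of_common_paths`); hence, after a pigeonhole step, each theta
interferes with few tails, and a digraph of bounded in-degree has a large independent set. Finally,
`t` paths of one theta cannot all be joined to `t` paths of another, so `exists_unrelated` selects
`q` paths of each theta with no edges between different thetas. -/

lemma isInducedPath_nil (a : V) : IsInducedPath (Walk.nil : G.Walk a a) := by
  refine ⟨Walk.IsPath.nil, ?_⟩
  rw [Walk.isChordless_iff_forall_mem_edges]
  intro u v hu hv h
  simp only [Walk.support_nil, List.mem_singleton] at hu hv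
  exact absurd (hu.trans hv.symm) h.ne

lemma isInducedPath_cons_iff {a b c : V} (h : G.Adj a b) (p : G.Walk b c) :
    IsInducedPath (Walk.cons h p) ↔
      IsInducedPath p ∧ a ∉ p.support ∧ ∀ w ∈ p.support, G.Adj a w → w = b := by
  unfold IsInducedPath
  rw [Walk.cons_isPath_iff, Walk.isChordless_iff_forall_mem_edges,
    Walk.isChordless_iff_forall_mem_edges]
  constructor
  · rintro ⟨⟨hp, ha⟩, hc⟩
    refine ⟨⟨hp, ?_⟩, ha, ?_⟩
    · intro u v hu hv huv
      have := hc (u' := u) (v' := v) (by simp [hu]) (by simp [hv]) huv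
      rw [Walk.edges_cons, List.mem_cons] at this
      rcases this with h1 | h1
      · rw [Sym2.eq_iff] at h1
        rcases h1 with ⟨rfl, -⟩ | ⟨-, rfl⟩ <;> contradiction
      · exact h1
    · intro w hw haw
      have := hc (u' := a) (v' := w) (by simp) (by simp [hw]) haw
      rw [Walk.edges_cons, List.mem_cons] at this
      rcases this with h1 | h1
      · rw [Sym2.eq_iff] at h1
        rcases h1 with ⟨-, h1⟩ | ⟨h1, h2⟩
        · exact h1
        · exact absurd h1 h.ne
      · exact absurd (Walk.fst_mem_support_of_mem_edges _ h1) ha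
  · rintro ⟨⟨hp, hc⟩, ha, hn⟩
    refine ⟨⟨hp, ha⟩, ?_⟩
    intro u v hu hv huv
    rw [Walk.support_cons, List.mem_cons] at hu hv
    rw [Walk.edges_cons, List.mem_cons]
    rcases hu with rfl | hu <;> rcases hv with rfl | hv
    · exact absurd rfl huv.ne
    · left; rw [hn v hv huv]
    · left; rw [hn u hu huv.symm, Sym2.eq_swap]
    · right; exact hc hu hv huv

lemma IsInducedPath.reverse {a b : V} {p : G.Walk a b} (h : IsInducedPath p) :
    IsInducedPath p.reverse := by
  refine ⟨h.1.reverse, ?_⟩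
  rw [Walk.isChordless_iff_forall_mem_edges]
  intro u v hu hv huv
  rw [Walk.support_reverse, List.mem_reverse] at hu hv
  rw [Walk.edges_reverse, List.mem_reverse]
  exact h.2.mem_edges hu hv huv

lemma walkVerts_reverse {a b : V} (p : G.Walk a b) : walkVerts p.reverse = walkVerts p := by
  ext w; simp [walkVerts]

lemma walkVerts_cons {a b c : V} (h : G.Adj a b) (p : G.Walk b c) :
    walkVerts (Walk.cons h p) = insert a (walkVerts p) := by
  ext w; simp [walkVerts]

lemma walkVerts_nil (a : V) : walkVerts (Walk.nil : G.Walk a a) = {a} := by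
  ext w; simp [walkVerts]

lemma walkVerts_concat {a b c : V} (p : G.Walk a b) (h : G.Adj b c) :
    walkVerts (p.concat h) = insert c (walkVerts p) := by
  ext w; simp [walkVerts, Walk.support_concat, or_comm]

lemma start_mem_walkVerts {a b : V} (p : G.Walk a b) : a ∈ walkVerts p := p.start_mem_support

lemma end_mem_walkVerts {a b : V} (p : G.Walk a b) : b ∈ walkVerts p := p.end_mem_support

lemma mem_walkVerts_iff {a b w : V} {p : G.Walk a b} :
    w ∈ walkVerts p ↔ ∃ n, p.getVert n = w ∧ n ≤ p.length :=
  Walk.mem_support_iff_exists_getVert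

lemma IsInducedPath.cons {a b c : V} {p : G.Walk b c} (hp : IsInducedPath p) (h : G.Adj a b)
    (ha : a ∉ walkVerts p) (hn : ∀ w ∈ walkVerts p, G.Adj a w → w = b) :
    IsInducedPath (Walk.cons h p) :=
  (isInducedPath_cons_iff h p).2 ⟨hp, ha, hn⟩

lemma IsInducedPath.concat {a b c : V} {p : G.Walk a b} (hp : IsInducedPath p) (h : G.Adj b c)
    (hc : c ∉ walkVerts p) (hn : ∀ w ∈ walkVerts p, G.Adj c w → w = b) :
    IsInducedPath (p.concat h) := by
  have h1 : IsInducedPath (Walk.cons h.symm p.reverse) :=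
    hp.reverse.cons h.symm (by rwa [walkVerts_reverse]) (by rwa [walkVerts_reverse])
  have h2 := h1.reverse
  rw [Walk.reverse_cons, Walk.reverse_reverse] at h2
  exact h2

lemma IsInducedPath.adj_getVert_iff {a b : V} {p : G.Walk a b} (hp : IsInducedPath p) {i j : ℕ}
    (hi : i ≤ p.length) (hj : j ≤ p.length) :
    G.Adj (p.getVert i) (p.getVert j) ↔ i + 1 = j ∨ j + 1 = i := by
  induction p generalizing i j with
  | nil =>
    simp only [Walk.length_nil, Nat.le_zero] at hi hj
    subst hi hj
    simp
  | @cons a b c h p ih =>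
    obtain ⟨hp', ha, hn⟩ := (isInducedPath_cons_iff h p).1 hp
    have key : ∀ k, k ≤ p.length → (G.Adj a (p.getVert k) ↔ k = 0) := by
      intro k hk
      constructor
      · intro hadj
        have h1 := hn _ (p.getVert_mem_support k) hadj
        exact (hp'.1.getVert_eq_start_iff hk).1 h1
      · rintro rfl
        simpa using h
    rcases i with _ | i <;> rcases j with _ | j
    · simp
    · rw [Walk.getVert_cons_succ, Walk.getVert_zero, key j (by simpa using hj)]
      omega
    · rw [Walk.getVert_cons_succ, Walk.getVert_zero, G.adj_comm, key i (by simpa using hi)]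
      omega
    · rw [Walk.getVert_cons_succ, Walk.getVert_cons_succ,
        ih hp' (by simpa using hi) (by simpa using hj)]
      omega

lemma isInducedPath_of_getVert {a b : V} {p : G.Walk a b} (hp : p.IsPath)
    (h : ∀ i j, i < j → j ≤ p.length → G.Adj (p.getVert i) (p.getVert j) → i + 1 = j) :
    IsInducedPath p := by
  induction p with
  | nil => exact isInducedPath_nil _
  | @cons a b c hab p ih =>
    obtain ⟨hp', ha⟩ := (Walk.cons_isPath_iff hab p).1 hp
    refine (isInducedPath_cons_iff hab p).2 ⟨ih hp' ?_, ha, ?_⟩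
    · intro i j hij hj hadj
      have := h (i + 1) (j + 1) (by omega) (by simpa using hj)
        (by simpa [Walk.getVert_cons_succ] using hadj)
      omega
    · intro w hw haw
      obtain ⟨n, rfl, hn⟩ := Walk.mem_support_iff_exists_getVert.1 hw
      have := h 0 (n + 1) (by omega) (by simpa using hn)
        (by simpa [Walk.getVert_cons_succ] using haw)
      obtain rfl : n = 0 := by omega
      simp

lemma IsInducedPath.drop {a b : V} {p : G.Walk a b} (hp : IsInducedPath p) (n : ℕ) :
    IsInducedPath (p.drop n) := by
  refine isInducedPath_of_getVert (hp.1.drop n) ?_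
  intro i j hij hj hadj
  rw [Walk.drop_getVert, Walk.drop_getVert] at hadj
  rw [Walk.drop_length] at hj
  rw [hp.adj_getVert_iff (by omega) (by omega)] at hadj
  omega

lemma mem_walkVerts_drop_iff {a b w : V} {p : G.Walk a b} {n : ℕ} (hn : n ≤ p.length) :
    w ∈ walkVerts (p.drop n) ↔ ∃ i, n ≤ i ∧ i ≤ p.length ∧ p.getVert i = w := by
  rw [mem_walkVerts_iff]
  simp only [Walk.drop_getVert, Walk.drop_length]
  constructor
  · rintro ⟨m, h1, h2⟩
    exact ⟨n + m, by omega, by omega, h1⟩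
  · rintro ⟨i, h1, h2, h3⟩
    exact ⟨i - n, by rwa [Nat.add_sub_cancel' h1], by omega⟩

/-- An inner vertex of an induced path has exactly two neighbors on the path. -/
lemma IsInducedPath.ncard_neighbors {a b w : V} {p : G.Walk a b} (hp : IsInducedPath p)
    (hw : w ∈ pathInterior p) : (G.neighborSet w ∩ walkVerts p).ncard = 2 := by
  obtain ⟨hw, hab⟩ := hw
  obtain ⟨i, rfl, hi⟩ := mem_walkVerts_iff.1 hw
  have h0 : i ≠ 0 := by rintro rfl; simp at hab
  have h1 : i ≠ p.length := by rintro rfl; simp at hab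
  have : G.neighborSet (p.getVert i) ∩ walkVerts p = {p.getVert (i - 1), p.getVert (i + 1)} := by
    ext u
    simp only [Set.mem_inter_iff, mem_neighborSet, Set.mem_insert_iff, Set.mem_singleton_iff]
    constructor
    · rintro ⟨hu, hup⟩
      obtain ⟨j, rfl, hj⟩ := mem_walkVerts_iff.1 hup
      rw [hp.adj_getVert_iff hi hj] at hu
      rcases hu with rfl | rfl
      · right; rfl
      · left; simp
    · rintro (rfl | rfl)
      · exact ⟨(hp.adj_getVert_iff hi (by omega)).2 (by omega), p.getVert_mem_support _⟩
      · exact ⟨(hp.adj_getVert_iff hi (by omega)).2 (by omega), p.getVert_mem_support _⟩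
  rw [this, Set.ncard_pair]
  intro h
  have := hp.1.getVert_injOn (by simp; omega) (by simp; omega) h
  omega

/-! ### Connected vertex sets -/

/-- `a` and `b` are joined by a walk with all vertices in `X`. -/
def Joined (G : SimpleGraph V) (X : Set V) (a b : V) : Prop :=
  ∃ p : G.Walk a b, walkVerts p ⊆ X

namespace Joined

variable {X Y : Set V} {a b c : V}

lemma refl (ha : a ∈ X) : Joined G X a a := ⟨Walk.nil, by simpa [walkVerts_nil] using ha⟩

lemma symm (h : Joined G X a b) : Joined G X b a := by
  obtain ⟨p, hp⟩ := h
  exact ⟨p.reverse, by rwa [walkVerts_reverse]⟩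

lemma trans (h : Joined G X a b) (h' : Joined G X b c) : Joined G X a c := by
  obtain ⟨p, hp⟩ := h
  obtain ⟨q, hq⟩ := h'
  refine ⟨p.append q, fun w hw => ?_⟩
  rcases (Walk.mem_support_append_iff p q).1 hw with h | h
  · exact hp h
  · exact hq h

lemma mono (h : Joined G X a b) (hXY : X ⊆ Y) : Joined G Y a b := by
  obtain ⟨p, hp⟩ := h
  exact ⟨p, hp.trans hXY⟩

lemma of_adj (ha : a ∈ X) (hb : b ∈ X) (h : G.Adj a b) : Joined G X a b :=
  ⟨Walk.cons h Walk.nil, by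
    rw [walkVerts_cons, walkVerts_nil]
    rintro w (rfl | rfl) <;> assumption⟩

lemma left_mem (h : Joined G X a b) : a ∈ X := by
  obtain ⟨p, hp⟩ := h
  exact hp (start_mem_walkVerts p)

lemma right_mem (h : Joined G X a b) : b ∈ X := h.symm.left_mem

/-- A set closed under taking neighbors in `X` contains all that is joined to its elements. -/
lemma mem_of_closed (h : Joined G X a b) {P : V → Prop} (ha : P a)
    (hP : ∀ u v, u ∈ X → v ∈ X → G.Adj u v → P u → P v) : P b := by
  obtain ⟨p, hp⟩ := h
  induction p with
  | nil => exact ha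
  | @cons a c b hac p ih =>
    rw [walkVerts_cons, Set.insert_subset_iff] at hp
    exact ih (hP a c hp.1 (hp.2 (start_mem_walkVerts p)) hac ha) hp.2

end Joined

/-- The set `X` of vertices induces a connected subgraph (in particular it is non-empty). -/
def ConnSet (G : SimpleGraph V) (X : Set V) : Prop :=
  X.Nonempty ∧ ∀ a ∈ X, ∀ b ∈ X, Joined G X a b

lemma ConnSet.of_center {X : Set V} {a : V} (ha : a ∈ X) (h : ∀ b ∈ X, Joined G X b a) :
    ConnSet G X :=
  ⟨⟨a, ha⟩, fun b hb c hc => (h b hb).trans (h c hc).symm⟩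

lemma ConnSet.induce_connected {X : Set V} (h : ConnSet G X) : (G.induce X).Connected := by
  have : Nonempty X := h.1.to_subtype
  refine ⟨fun a b => ?_⟩
  obtain ⟨p, hp⟩ := h.2 a a.2 b b.2
  exact ⟨p.induce X hp⟩

lemma connSet_singleton (a : V) : ConnSet G {a} :=
  ConnSet.of_center (Set.mem_singleton a) (by rintro b rfl; exact Joined.refl rfl)

lemma joined_start_of_mem_walkVerts {a b w : V} (p : G.Walk a b) (hw : w ∈ walkVerts p) :
    Joined G (walkVerts p) w a := by
  classical
  exact Joined.symm ⟨p.takeUntil w hw, fun u hu => p.support_takeUntil_subset_support hw hu⟩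

lemma connSet_walkVerts {a b : V} (p : G.Walk a b) : ConnSet G (walkVerts p) :=
  ConnSet.of_center (start_mem_walkVerts p) fun _ hw => joined_start_of_mem_walkVerts p hw

lemma ConnSet.union {X Y : Set V} (hX : ConnSet G X) (hY : ConnSet G Y)
    (h : ∃ a ∈ X, ∃ b ∈ Y, G.Adj a b) : ConnSet G (X ∪ Y) := by
  obtain ⟨a, ha, b, hb, hab⟩ := h
  refine ConnSet.of_center (a := a) (Or.inl ha) ?_
  rintro c (hc | hc)
  · exact (hX.2 c hc a ha).mono Set.subset_union_left
  · exact ((hY.2 c hc b hb).mono Set.subset_union_right).trans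
      (Joined.of_adj (Or.inr hb) (Or.inl ha) hab.symm)

lemma ConnSet.insert {X : Set V} (hX : ConnSet G X) {a : V} (h : ∃ b ∈ X, G.Adj a b) :
    ConnSet G (insert a X) := by
  obtain ⟨b, hb, hab⟩ := h
  exact (connSet_singleton a).union hX ⟨a, rfl, b, hb, hab⟩

/-- The part of an induced path without its last vertex is connected. -/
lemma connSet_walkVerts_diff_end {a b : V} {p : G.Walk a b} (hp : p.IsPath) (hab : a ≠ b) :
    ConnSet G (walkVerts p \ {b}) ∧ ∃ c ∈ walkVerts p \ {b}, G.Adj c b := by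
  have hn : ¬ p.Nil := fun h => hab h.eq
  have hq : walkVerts p \ {b} = walkVerts p.dropLast := by
    have h1 : walkVerts p = Insert.insert b (walkVerts p.dropLast) := by
      conv_lhs => rw [← Walk.concat_dropLast (p.adj_penultimate hn)]
      exact walkVerts_concat _ _
    have h2 : b ∉ walkVerts p.dropLast := by
      have := hp
      rw [← Walk.concat_dropLast (p.adj_penultimate hn), Walk.concat_isPath_iff] at this
      exact this.2
    rw [h1]
    ext w
    simp only [Set.mem_sdiff, Set.mem_insert_iff, Set.mem_singleton_iff]
    constructor
    · rintro ⟨h | h, h'⟩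
      · exact absurd h h'
      · exact h
    · intro h
      exact ⟨Or.inr h, fun h' => h2 (h' ▸ h)⟩
  rw [hq]
  exact ⟨connSet_walkVerts _, _, end_mem_walkVerts _, p.adj_penultimate hn⟩

/-- In a connected set `X` there is an induced path from a given vertex to a target set `T`, all of
whose vertices but the last are outside of `T`. -/
lemma exists_inducedPath_firstTouch {X T : Set V} (hX : ConnSet G X) {a : V} (ha : a ∈ X)
    (hT : ∃ b ∈ X, b ∈ T) :
    ∃ (r : V) (p : G.Walk a r), IsInducedPath p ∧ walkVerts p ⊆ X ∧ r ∈ T ∧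
      ∀ w ∈ walkVerts p, w ∈ T → w = r := by
  classical
  -- A shortest walk in `X` from `a` to `T` will do: a chord, a repeated vertex or an earlier visit
  -- to `T` would yield a shorter one. Minimality is stated against all walks to all vertices of
  -- `T`, so that it passes to the tail of the walk in the induction.
  have hex : ∃ n, ∃ (r : V) (p : G.Walk a r), walkVerts p ⊆ X ∧ r ∈ T ∧ p.length = n := by
    obtain ⟨b, hb, hbT⟩ := hT
    obtain ⟨p, hp⟩ := hX.2 a ha b hb
    exact ⟨_, b, p, hp, hbT, rfl⟩
  have hmin := fun m => Nat.find_min (m := m) hex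
  obtain ⟨r, p, hp, hr, hl⟩ := Nat.find_spec hex
  generalize Nat.find hex = n at hmin hl
  subst hl
  replace hmin : ∀ (r' : V) (q : G.Walk a r'), walkVerts q ⊆ X → r' ∈ T → p.length ≤ q.length := by
    intro r' q hq hr'
    by_contra hlt
    exact hmin _ (not_le.1 hlt) ⟨r', q, hq, hr', rfl⟩
  clear ha hT hex hX
  have main : IsInducedPath p ∧ ∀ w ∈ walkVerts p, w ∈ T → w = r := by
    induction p with
    | nil =>
      refine ⟨isInducedPath_nil _, fun w hw _ => ?_⟩
      simpa [walkVerts_nil] using hw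
    | @cons a b c hab p ih =>
      rw [walkVerts_cons, Set.insert_subset_iff] at hp
      obtain ⟨haX, hp⟩ := hp
      have hmin' : ∀ (r' : V) (q : G.Walk b r'), walkVerts q ⊆ X → r' ∈ T →
          p.length ≤ q.length := by
        intro r' q hq hr'
        have := hmin r' (Walk.cons hab q)
          (by rw [walkVerts_cons]; exact Set.insert_subset haX hq) hr'
        simpa using this
      obtain ⟨ih1, ih2⟩ := ih hp hr hmin'
      have shortcut : ∀ w (hw : w ∈ p.support), G.Adj a w → w = b := by
        intro w hw haw
        have h1 := hmin _ (Walk.cons haw (p.dropUntil w hw)) (by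
          rw [walkVerts_cons]
          exact Set.insert_subset haX
            (fun u hu => hp (p.support_dropUntil_subset_support hw hu))) hr
        have h2 := congrArg Walk.length (p.take_spec hw)
        rw [Walk.length_append] at h2
        simp only [Walk.length_cons] at h1
        have h3 : (p.takeUntil w hw).length = 0 := by omega
        exact (Walk.eq_of_length_eq_zero h3).symm
      have hnot : a ∉ p.support := by
        intro haS
        have h1 := hmin _ (p.dropUntil a haS)
          (fun u hu => hp (p.support_dropUntil_subset_support haS hu)) hr
        have h2 := p.length_dropUntil_le_length haS
        simp only [Walk.length_cons] at h1
        omega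
      refine ⟨(isInducedPath_cons_iff hab p).2 ⟨ih1, hnot, shortcut⟩, ?_⟩
      intro w hw hwT
      rw [walkVerts_cons] at hw
      rcases hw with rfl | hw
      · have := hmin w Walk.nil (by rw [walkVerts_nil]; simpa using haX) hwT
        simp at this
      · exact ih2 w hw hwT
  exact ⟨r, p, main.1, hp, hr, main.2⟩

lemma exists_inducedPath {X : Set V} (hX : ConnSet G X) {a b : V} (ha : a ∈ X) (hb : b ∈ X) :
    ∃ p : G.Walk a b, IsInducedPath p ∧ walkVerts p ⊆ X := by
  obtain ⟨r, p, h1, h2, h3, -⟩ := exists_inducedPath_firstTouch (T := {b}) hX ha ⟨b, hb, rfl⟩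
  obtain rfl : r = b := h3
  exact ⟨p, h1, h2⟩

/-- `a` has a neighbor in `X`. -/
def Touches (G : SimpleGraph V) (a : V) (X : Set V) : Prop := ∃ b ∈ X, G.Adj a b

lemma Touches.mono {a : V} {X Y : Set V} (h : Touches G a X) (hXY : X ⊆ Y) : Touches G a Y := by
  obtain ⟨b, hb, hab⟩ := h
  exact ⟨b, hXY hb, hab⟩

/-! ### Anticomplete sets and tidy graphs -/

lemma Anticomplete.symm {X Y : Set V} (h : Anticomplete G X Y) : Anticomplete G Y X :=
  ⟨h.1.symm, fun a ha b hb hab => h.2 b hb a ha hab.symm⟩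

lemma Anticomplete.mono {X Y X' Y' : Set V} (h : Anticomplete G X Y) (hX : X' ⊆ X) (hY : Y' ⊆ Y) :
    Anticomplete G X' Y' :=
  ⟨h.1.mono hX hY, fun a ha b hb => h.2 a (hX ha) b (hY hb)⟩

/-- In a `t`-tidy graph there are no two families of `t` connected, pairwise anticomplete sets such
that the sets of the first family are disjoint from, and joined by edges to, the sets of the
second. -/
lemma IsTidy.no_bipartite {t : ℕ} (hG : IsTidy G t) (X Y : Fin t → Set V)
    (hX : ∀ i, ConnSet G (X i)) (hY : ∀ i, ConnSet G (Y i))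
    (hXX : ∀ i j, i ≠ j → Anticomplete G (X i) (X j))
    (hYY : ∀ i j, i ≠ j → Anticomplete G (Y i) (Y j))
    (hXY : ∀ i j, Disjoint (X i) (Y j)) (hadj : ∀ i j, ∃ a ∈ X i, ∃ b ∈ Y j, G.Adj a b) :
    False := by
  refine hG.2 ⟨Sum.elim X Y, ?_, ?_, ?_⟩
  · rintro (i | i)
    · exact (hX i).induce_connected
    · exact (hY i).induce_connected
  · rintro (i | i) (j | j) hij
    · exact (hXX i j (by simpa using hij)).1
    · exact hXY i j
    · exact (hXY j i).symm
    · exact (hYY i j (by simpa using hij)).1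
  · rintro (i | i) (j | j) hij
    · simp only [Sum.elim_inl, completeBipartiteGraph_adj]
      simp only [Sum.isLeft_inl, Sum.isRight_inl, Bool.false_eq_true, and_false, false_and,
        or_self, iff_false]
      rintro ⟨a, ha, b, hb, hab⟩
      exact (hXX i j (by simpa using hij)).2 a ha b hb hab
    · simpa using hadj i j
    · simp only [Sum.elim_inl, Sum.elim_inr, completeBipartiteGraph_adj]
      obtain ⟨a, ha, b, hb, hab⟩ := hadj j i
      simpa using ⟨b, hb, a, ha, hab.symm⟩
    · simp only [Sum.elim_inr, completeBipartiteGraph_adj]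
      simp only [Sum.isLeft_inr, Sum.isRight_inr, Bool.false_eq_true, false_and, and_false,
        or_self, iff_false]
      rintro ⟨a, ha, b, hb, hab⟩
      exact (hYY i j (by simpa using hij)).2 a ha b hb hab

/-! ### Ramsey's theorem -/

/-- Ramsey's theorem: a large set of vertices contains a clique on `c` vertices or a stable set
on `m` vertices. -/
theorem exists_ramsey (c m : ℕ) : ∃ n : ℕ, ∀ {α : Type*} (H : SimpleGraph α) (S : Finset α),
    n ≤ S.card → (∃ A ⊆ S, A.card = c ∧ ∀ a ∈ A, ∀ b ∈ A, a ≠ b → H.Adj a b) ∨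
      (∃ A ⊆ S, A.card = m ∧ ∀ a ∈ A, ∀ b ∈ A, ¬ H.Adj a b) := by
  induction c generalizing m with
  | zero => exact ⟨0, fun H S _ => Or.inl ⟨∅, by simp, by simp, by simp⟩⟩
  | succ c ihc =>
    induction m with
    | zero => exact ⟨0, fun H S _ => Or.inr ⟨∅, by simp, by simp, by simp⟩⟩
    | succ m ihm =>
      obtain ⟨n₁, h₁⟩ := ihc (m + 1)
      obtain ⟨n₂, h₂⟩ := ihm
      refine ⟨n₁ + n₂ + 1, fun {α} H S hS => ?_⟩
      classical
      obtain ⟨v, hv⟩ : S.Nonempty := Finset.card_pos.1 (by omega)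
      have hcard := Finset.card_erase_of_mem hv
      have hsplit := Finset.card_filter_add_card_filter_not (s := S.erase v) (fun u => H.Adj v u)
      by_cases h : n₁ ≤ ((S.erase v).filter (fun u => H.Adj v u)).card
      · rcases h₁ H _ h with ⟨A, hA, hc, hadj⟩ | ⟨A, hA, hc, hadj⟩
        · left
          have hvA : v ∉ A := fun hvA => by simpa using hA hvA
          refine ⟨insert v A, ?_, by rw [Finset.card_insert_of_notMem hvA, hc], ?_⟩
          · refine Finset.insert_subset hv (hA.trans ((Finset.filter_subset _ _).trans
              (Finset.erase_subset _ _)))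
          · have hv' : ∀ a ∈ A, H.Adj v a := fun a ha => (Finset.mem_filter.1 (hA ha)).2
            intro a ha b hb hab
            rcases Finset.mem_insert.1 ha with rfl | ha' <;>
              rcases Finset.mem_insert.1 hb with rfl | hb'
            · exact absurd rfl hab
            · exact hv' b hb'
            · exact (hv' a ha').symm
            · exact hadj a ha' b hb' hab
        · right
          exact ⟨A, hA.trans ((Finset.filter_subset _ _).trans (Finset.erase_subset _ _)), hc, hadj⟩
      · rcases h₂ H ((S.erase v).filter (fun u => ¬ H.Adj v u)) (by omega) with
          ⟨A, hA, hc, hadj⟩ | ⟨A, hA, hc, hadj⟩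
        · left
          exact ⟨A, hA.trans ((Finset.filter_subset _ _).trans (Finset.erase_subset _ _)), hc, hadj⟩
        · right
          have hvA : v ∉ A := fun hvA => by simpa using hA hvA
          refine ⟨insert v A, ?_, by rw [Finset.card_insert_of_notMem hvA, hc], ?_⟩
          · refine Finset.insert_subset hv (hA.trans ((Finset.filter_subset _ _).trans
              (Finset.erase_subset _ _)))
          · have hv' : ∀ a ∈ A, ¬ H.Adj v a := fun a ha => (Finset.mem_filter.1 (hA ha)).2
            intro a ha b hb
            rcases Finset.mem_insert.1 ha with rfl | ha' <;>
              rcases Finset.mem_insert.1 hb with rfl | hb'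
            · exact H.loopless.irrefl _
            · exact hv' b hb'
            · exact fun h => hv' a ha' h.symm
            · exact hadj a ha' b hb'

/-- In a graph without clique on `t + 1` vertices, every large family of distinct vertices has a
stable subfamily of size `m`. -/
theorem exists_stable_bound (t m : ℕ) : ∃ n : ℕ, ∀ {V : Type*} {α : Type*} (G : SimpleGraph V)
    (S : Finset α) (f : α → V), G.CliqueFree (t + 1) → Set.InjOn f S → n ≤ S.card →
      ∃ A ⊆ S, A.card = m ∧ ∀ a ∈ A, ∀ b ∈ A, ¬ G.Adj (f a) (f b) := by
  obtain ⟨n, hn⟩ := exists_ramsey (t + 1) m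
  refine ⟨n, fun {V α} G S f hG hf hS => ?_⟩
  classical
  rcases hn (G.comap f) S hS with ⟨A, hA, hc, hadj⟩ | ⟨A, hA, hc, hadj⟩
  · exfalso
    refine hG (A.image f) ⟨?_, ?_⟩
    · intro a ha b hb hab
      simp only [Finset.coe_image, Set.mem_image, Finset.mem_coe] at ha hb
      obtain ⟨a, ha, rfl⟩ := ha
      obtain ⟨b, hb, rfl⟩ := hb
      exact hadj a ha b hb (fun h => hab (by rw [h]))
    · rw [Finset.card_image_of_injOn (hf.mono (by exact_mod_cast hA)), hc]
  · exact ⟨A, hA, hc, hadj⟩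

/-! ### Spreading neighbors over the positions of a path -/

open Finset in
open scoped Classical in
/-- If every position is related to less than `N` elements and few positions are related to
the same `t` elements, then one can choose `s` elements such that no position is related to more
than `t` of them. -/
lemma exists_spread (t T N s : ℕ) : ∃ n : ℕ, ∀ {α : Type*} (S : Finset α) (A : α → ℕ → Prop)
    (i₀ l : ℕ),
    (∀ U ⊆ S, U.card = t → ∀ J : Finset ℕ,
      (∀ j ∈ J, i₀ ≤ j ∧ j ≤ l ∧ ∀ a ∈ U, A a j) → J.card < T) →
    (∀ i, i₀ ≤ i → i ≤ l → (S.filter (fun a => A a i)).card < N) → n ≤ S.card →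
    ∃ S' ⊆ S, S'.card = s ∧ ∀ i, i₀ ≤ i → i ≤ l → (S'.filter (fun a => A a i)).card ≤ t := by
  induction s with
  | zero => exact ⟨0, fun S A i₀ l _ _ _ => ⟨∅, by simp, by simp, by simp⟩⟩
  | succ s ih =>
    obtain ⟨n, hn⟩ := ih
    -- Room for the `s` elements already chosen and for the forbidden ones: at most `s.choose t * T`
    -- positions are saturated, and each forbids fewer than `N` elements.
    refine ⟨n + (s + s.choose t * T * N + 1), fun {α} S A i₀ l hno hdeg hS => ?_⟩
    obtain ⟨S', hS', hc, hle⟩ := hn S A i₀ l hno hdeg (by omega)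
    -- The saturated positions. Each is common to some `t`-subset of `S'`, and each such subset has
    -- fewer than `T` common positions.
    set J := (Icc i₀ l).filter (fun i => t ≤ (S'.filter (fun a => A a i)).card) with hJ
    have hJcard : J.card ≤ s.choose t * T := by
      have hsub : J ⊆ (S'.powersetCard t).biUnion
          (fun U => (Icc i₀ l).filter (fun i => ∀ a ∈ U, A a i)) := by
        intro i hi
        obtain ⟨hi1, hi2⟩ := mem_filter.1 hi
        obtain ⟨U, hU, hUc⟩ := exists_subset_card_eq hi2
        rw [mem_biUnion]
        exact ⟨U, mem_powersetCard.2 ⟨hU.trans (filter_subset _ _), hUc⟩,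
          mem_filter.2 ⟨hi1, fun a ha => (mem_filter.1 (hU ha)).2⟩⟩
      refine (card_le_card hsub).trans ?_
      refine (card_biUnion_le_card_mul _ _ T ?_).trans (by rw [card_powersetCard, hc])
      intro U hU
      obtain ⟨hU1, hU2⟩ := mem_powersetCard.1 hU
      refine (hno U (hU1.trans hS') hU2 _ ?_).le
      intro j hj
      obtain ⟨h1, h2⟩ := mem_filter.1 hj
      exact ⟨(mem_Icc.1 h1).1, (mem_Icc.1 h1).2, h2⟩
    have hbad : (J.biUnion (fun i => S.filter (fun a => A a i))).card ≤ s.choose t * T * N := by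
      refine (card_biUnion_le_card_mul _ _ N ?_).trans (Nat.mul_le_mul_right _ hJcard)
      intro i hi
      have := mem_Icc.1 (mem_filter.1 hi).1
      exact (hdeg i this.1 this.2).le
    obtain ⟨a, haS, ha⟩ : ∃ a ∈ S, a ∉ S' ∪ J.biUnion (fun i => S.filter (fun a => A a i)) := by
      apply exists_mem_notMem_of_card_lt_card
      have := card_union_le S' (J.biUnion (fun i => S.filter (fun a => A a i)))
      omega
    rw [mem_union, not_or] at ha
    refine ⟨insert a S', insert_subset haS hS', by rw [card_insert_of_notMem ha.1, hc], ?_⟩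
    intro i hi hil
    rw [filter_insert]
    split_ifs with hai
    · have : i ∉ J := fun hiJ => ha.2 (mem_biUnion.2 ⟨i, hiJ, mem_filter.2 ⟨haS, hai⟩⟩)
      have h1 : ¬ t ≤ (S'.filter (fun a => A a i)).card := fun h =>
        this (mem_filter.2 ⟨mem_Icc.2 ⟨hi, hil⟩, h⟩)
      exact (card_insert_le _ _).trans (by omega)
    · exact hle i hi hil

open Finset in
open scoped Classical in
-- Induction on `r`, the number of common positions still to be found. If every position from `i₀`
-- on has few elements, `exists_spread` applies. Otherwise some position `j` has at least `n + Q`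
-- elements: either `Q` of them have no later position, or at least `n` go on beyond `j`, and the
-- argument restarts with these from `j + 1`, having gained `j` as a common position.
lemma exists_spread_or_last_aux (t T s Q r : ℕ) : ∃ n : ℕ, ∀ {α : Type*} (S : Finset α)
    (A : α → ℕ → Prop) (i₀ l : ℕ),
    (∀ U ⊆ S, U.card = t → ∀ J : Finset ℕ, (∀ j ∈ J, j ≤ l ∧ ∀ a ∈ U, A a j) → J.card < T) →
    (∀ a ∈ S, ∃ i, i₀ ≤ i ∧ i ≤ l ∧ A a i) → n ≤ S.card →
    (∃ j ≤ l, ∃ S' ⊆ S, S'.card = s ∧ (∀ a ∈ S', ∃ i, j ≤ i ∧ i ≤ l ∧ A a i) ∧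
      ∀ i, j ≤ i → i ≤ l → (S'.filter (fun a => A a i)).card ≤ t) ∨
    (∃ j ≤ l, ∃ S' ⊆ S, S'.card = Q ∧ ∀ a ∈ S', A a j ∧ ∀ i, j < i → i ≤ l → ¬ A a i) ∨
    (∃ J : Finset ℕ, J.card = r ∧ (∀ j ∈ J, i₀ ≤ j ∧ j ≤ l) ∧
      ∃ U ⊆ S, U.card = t ∧ ∀ a ∈ U, ∀ j ∈ J, A a j) := by
  induction r with
  | zero =>
    refine ⟨t, fun S A i₀ l _ _ hS => ?_⟩
    obtain ⟨U, hU, hUc⟩ := exists_subset_card_eq hS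
    exact Or.inr (Or.inr ⟨∅, rfl, by simp, U, hU, hUc, by simp⟩)
  | succ r ih =>
    obtain ⟨n, hn⟩ := ih
    obtain ⟨m, hm⟩ := exists_spread t T (n + Q) s
    -- The extra element makes `S` non-empty, which is where `i₀ ≤ l` comes from.
    refine ⟨m + 1, fun {α} S A i₀ l hno hA hS => ?_⟩
    by_cases hdeg : ∀ i, i₀ ≤ i → i ≤ l → (S.filter (fun a => A a i)).card < n + Q
    · left
      obtain ⟨S', hS', hc, hle⟩ := hm S A i₀ l (fun U hU hUc J hJ =>
        hno U hU hUc J (fun j hj => (hJ j hj).2)) hdeg (by omega)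
      obtain ⟨a, ha⟩ : S.Nonempty := card_pos.1 (by omega)
      obtain ⟨i, h1, h2, -⟩ := hA a ha
      exact ⟨i₀, h1.trans h2, S', hS', hc, fun a ha => hA a (hS' ha), hle⟩
    · push Not at hdeg
      obtain ⟨j, hj₀, hjl, hj⟩ := hdeg
      set S₁ := S.filter (fun a => A a j) with hS₁
      have hsplit := card_filter_add_card_filter_not (s := S₁)
        (fun a => ∃ i, j + 1 ≤ i ∧ i ≤ l ∧ A a i)
      by_cases hlast : Q ≤ (S₁.filter (fun a => ¬ ∃ i, j + 1 ≤ i ∧ i ≤ l ∧ A a i)).card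
      · right; left
        obtain ⟨S', hS', hc⟩ := exists_subset_card_eq hlast
        refine ⟨j, hjl, S', hS'.trans ((filter_subset _ _).trans (filter_subset _ _)), hc, ?_⟩
        intro a ha
        obtain ⟨h1, h2⟩ := mem_filter.1 (hS' ha)
        exact ⟨(mem_filter.1 h1).2, fun i hi hil hai => h2 ⟨i, hi, hil, hai⟩⟩
      · set S₂ := S₁.filter (fun a => ∃ i, j + 1 ≤ i ∧ i ≤ l ∧ A a i) with hS₂
        have hS₂S : S₂ ⊆ S := (filter_subset _ _).trans (filter_subset _ _)
        rcases hn S₂ A (j + 1) l (fun U hU => hno U (hU.trans hS₂S))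
          (fun a ha => (mem_filter.1 ha).2) (by omega) with
          ⟨i, hi, S', hS', h⟩ | ⟨i, hi, S', hS', h⟩ | ⟨J, hJ, hJl, U, hU, hUc, h⟩
        · exact Or.inl ⟨i, hi, S', hS'.trans hS₂S, h⟩
        · exact Or.inr (Or.inl ⟨i, hi, S', hS'.trans hS₂S, h⟩)
        · right; right
          refine ⟨insert j J, ?_, ?_, U, hU.trans hS₂S, hUc, ?_⟩
          · rw [card_insert_of_notMem, hJ]
            intro hjJ
            have := (hJl j hjJ).1
            omega
          · intro i hi
            rcases mem_insert.1 hi with rfl | hi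
            · exact ⟨hj₀, hjl⟩
            · exact ⟨by have := (hJl i hi).1; omega, (hJl i hi).2⟩
          · intro a ha i hi
            rcases mem_insert.1 hi with rfl | hi
            · exact (mem_filter.1 (mem_filter.1 (hU ha)).1).2
            · exact h a ha i hi

open scoped Classical in
/-- Let the elements of a large set `S` be related to positions `0, …, l`, each to at least one,
and suppose that no `t` elements have `T` common positions. Then `s` of the elements are spread over
the positions from some `j` on, or `Q` of them have the same last position. -/
lemma exists_spread_or_last (t T s Q : ℕ) : ∃ n : ℕ, ∀ {α : Type*} (S : Finset α)
    (A : α → ℕ → Prop) (l : ℕ),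
    (∀ U ⊆ S, U.card = t → ∀ J : Finset ℕ, (∀ j ∈ J, j ≤ l ∧ ∀ a ∈ U, A a j) → J.card < T) →
    (∀ a ∈ S, ∃ i ≤ l, A a i) → n ≤ S.card →
    (∃ j ≤ l, ∃ S' ⊆ S, S'.card = s ∧ (∀ a ∈ S', ∃ i, j ≤ i ∧ i ≤ l ∧ A a i) ∧
      ∀ i, j ≤ i → i ≤ l → (S'.filter (fun a => A a i)).card ≤ t) ∨
    (∃ j ≤ l, ∃ S' ⊆ S, S'.card = Q ∧ ∀ a ∈ S', A a j ∧ ∀ i, j < i → i ≤ l → ¬ A a i) := by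
  -- With `r = T` the third outcome contradicts the hypothesis.
  obtain ⟨n, hn⟩ := exists_spread_or_last_aux t T s Q T
  refine ⟨n, fun S A l hno hA hS => ?_⟩
  rcases hn S A 0 l hno (fun a ha => by simpa using hA a ha) hS with
    h | h | ⟨J, hJ, hJl, U, hU, hUc, h⟩
  · exact Or.inl h
  · exact Or.inr h
  · have := hno U hU hUc J (fun j hj => ⟨(hJl j hj).2, fun a ha => h a ha j hj⟩)
    omega

lemma exists_fin_enum {α : Type*} {S : Finset α} {n : ℕ} (h : S.card = n) :
    ∃ e : Fin n → α, Function.Injective e ∧ (∀ i, e i ∈ S) ∧ ∀ a ∈ S, ∃ i, e i = a := by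
  refine ⟨fun i => ((S.equivFinOfCardEq h).symm i : α), ?_, fun i => Subtype.mem _, ?_⟩
  · exact Subtype.val_injective.comp (Equiv.injective _)
  · intro a ha
    exact ⟨S.equivFinOfCardEq h ⟨a, ha⟩, by simp⟩

/-- Variant of `IsTidy.no_bipartite` for families indexed by finsets of size `t`. -/
lemma IsTidy.no_bipartite_finset {t : ℕ} (hG : IsTidy G t) {α β : Type*} {A : Finset α}
    {B : Finset β} (hA : A.card = t) (hB : B.card = t) (X : α → Set V) (Y : β → Set V)
    (hX : ∀ i ∈ A, ConnSet G (X i)) (hY : ∀ i ∈ B, ConnSet G (Y i))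
    (hXX : ∀ i ∈ A, ∀ j ∈ A, i ≠ j → Anticomplete G (X i) (X j))
    (hYY : ∀ i ∈ B, ∀ j ∈ B, i ≠ j → Anticomplete G (Y i) (Y j))
    (hXY : ∀ i ∈ A, ∀ j ∈ B, Disjoint (X i) (Y j))
    (hadj : ∀ i ∈ A, ∀ j ∈ B, ∃ a ∈ X i, ∃ b ∈ Y j, G.Adj a b) : False := by
  obtain ⟨e, he, heA, -⟩ := exists_fin_enum hA
  obtain ⟨f, hf, hfB, -⟩ := exists_fin_enum hB
  exact hG.no_bipartite (fun i => X (e i)) (fun i => Y (f i)) (fun i => hX _ (heA i))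
    (fun i => hY _ (hfB i)) (fun i j hij => hXX _ (heA i) _ (heA j) (he.ne hij))
    (fun i j hij => hYY _ (hfB i) _ (hfB j) (hf.ne hij)) (fun i j => hXY _ (heA i) _ (hfB j))
    (fun i j => hadj _ (heA i) _ (hfB j))

/-! ### Legs at a vertex, domes and hubs -/

lemma anticomplete_singleton {a b : V} (hab : a ≠ b) (h : ¬ G.Adj a b) :
    Anticomplete G {a} {b} :=
  ⟨by simpa using hab, by rintro _ rfl _ rfl; exact h⟩

/-- Pairwise anticomplete connected sets `X b`, each meeting the neighborhood of `x` exactly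
in `σ b`. -/
structure IsLegs {β : Type*} (G : SimpleGraph V) (x : V) (B : Finset β) (X : β → Set V)
    (σ : β → V) : Prop where
  conn : ∀ b ∈ B, ConnSet G (X b)
  mem : ∀ b ∈ B, σ b ∈ X b
  adj : ∀ b ∈ B, G.Adj x (σ b)
  only : ∀ b ∈ B, ∀ w ∈ X b, G.Adj x w → w = σ b
  notMem : ∀ b ∈ B, x ∉ X b
  anti : ∀ b ∈ B, ∀ c ∈ B, b ≠ c → Anticomplete G (X b) (X c)

lemma IsLegs.mono {β : Type*} {x : V} {B B' : Finset β} {X : β → Set V} {σ : β → V}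
    (h : IsLegs G x B X σ) (hB : B' ⊆ B) : IsLegs G x B' X σ where
  conn b hb := h.conn b (hB hb)
  mem b hb := h.mem b (hB hb)
  adj b hb := h.adj b (hB hb)
  only b hb := h.only b (hB hb)
  notMem b hb := h.notMem b (hB hb)
  anti b hb c hc := h.anti b (hB hb) c (hB hc)

/-- The union of `x` and legs, cut to paths `R i` ending in the neighborhood of a path `p`,
is a dome together with `p` if the ends of the legs are spread over `p`. -/
lemma nonempty_dome {β : Type*} {x : V} {B : Finset β} {X : β → Set V} {σ : β → V}
    (hL : IsLegs G x B X σ) {y z : V} {p : G.Walk y z} (hp : IsInducedPath p)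
    (hxp : x ∉ walkVerts p) (hxp' : ∀ w ∈ walkVerts p, ¬ G.Adj x w)
    (hdisj : ∀ b ∈ B, Disjoint (X b) (walkVerts p)) {s d : ℕ} (e : Fin s → β)
    (he : Function.Injective e) (heB : ∀ i, e i ∈ B) (r : Fin s → V)
    (R : ∀ i, G.Walk (σ (e i)) (r i)) (hR : ∀ i, IsInducedPath (R i))
    (hRX : ∀ i, walkVerts (R i) ⊆ X (e i))
    (honly : ∀ i, ∀ w ∈ walkVerts (R i), Touches G w (walkVerts p) → w = r i)
    (htouch : ∀ i, Touches G (r i) (walkVerts p))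
    (hdeg : ∀ v ∈ walkVerts p, (G.neighborSet v ∩ Set.range r).ncard ≤ d) :
    Nonempty (Dome G x s d) := by
  have hxR : ∀ i, x ∉ walkVerts (R i) := fun i h => hL.notMem _ (heB i) (hRX i h)
  have hleg : ∀ i, walkVerts (Walk.cons (hL.adj _ (heB i)) (R i)) \ {x} = walkVerts (R i) := by
    intro i
    rw [walkVerts_cons]
    ext w
    simp only [Set.mem_sdiff, Set.mem_insert_iff, Set.mem_singleton_iff]
    constructor
    · rintro ⟨h | h, h'⟩
      · exact absurd h h'
      · exact h
    · intro h
      exact ⟨Or.inr h, fun h' => hxR i (h' ▸ h)⟩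
  let S : SubdividedStar G x s :=
    { leaf := r
      leaf_ne := fun i h => hxR i (h ▸ end_mem_walkVerts (R i))
      leg := fun i => Walk.cons (hL.adj _ (heB i)) (R i)
      leg_isInducedPath := fun i => (hR i).cons _ (hxR i)
        (fun w hw hxw => hL.only _ (heB i) w (hRX i hw) hxw)
      legs_anticomplete := fun i j hij => by
        rw [hleg, hleg]
        exact (hL.anti _ (heB i) _ (heB j) (he.ne hij)).mono (hRX i) (hRX j) }
  have hS : ∀ w ∈ S.verts, w = x ∨ ∃ i, w ∈ walkVerts (R i) := by
    intro w hw
    rcases hw with hw | hw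
    · exact Or.inl hw
    · obtain ⟨i, hi⟩ := Set.mem_iUnion.1 hw
      have hi : w ∈ walkVerts (Walk.cons (hL.adj _ (heB i)) (R i)) := hi
      rw [walkVerts_cons] at hi
      rcases hi with hi | hi
      · exact Or.inl hi
      · exact Or.inr ⟨i, hi⟩
  have hSp : Disjoint S.verts (walkVerts p) := by
    rw [Set.disjoint_left]
    intro w hw hwp
    rcases hS w hw with rfl | ⟨i, hi⟩
    · exact hxp hwp
    · exact Set.disjoint_left.1 (hdisj _ (heB i)) (hRX i hi) hwp
  exact ⟨{
    star := S
    a := y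
    b := z
    path := p
    path_isInducedPath := hp
    disjoint := hSp
    anticomplete := by
      refine ⟨hSp.mono_left Set.sdiff_subset, ?_⟩
      rintro w ⟨hw, hwl⟩ v hv hwv
      rcases hS w hw with rfl | ⟨i, hi⟩
      · exact hxp' v hv hwv
      · exact hwl ⟨i, (honly i w hi ⟨v, hv, hwv⟩).symm⟩
    leaf_has_neighbor := by
      rintro w ⟨i, rfl⟩
      exact htouch i
    path_degree_le := hdeg }⟩

/-- If many legs at `x` touch an induced path `p` that is anticomplete to `x`, then there is a dome
with root `x` or many of the legs, cut where they first touch `p`, have the same last neighbor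
on `p`. -/
theorem exists_dome_or_hub (t s Q : ℕ) : ∃ n : ℕ, ∀ {V β : Type*} {G : SimpleGraph V} {x : V}
    {B : Finset β} {X : β → Set V} {σ : β → V}, IsTidy G t → IsLegs G x B X σ →
    ∀ {y z : V} (p : G.Walk y z), IsInducedPath p → x ∉ walkVerts p →
    (∀ w ∈ walkVerts p, ¬ G.Adj x w) → (∀ b ∈ B, Disjoint (X b) (walkVerts p)) →
    (∀ b ∈ B, ∃ a ∈ X b, Touches G a (walkVerts p)) → n ≤ B.card →
    Nonempty (Dome G x s t) ∨ ∃ j ≤ p.length, ∃ B' ⊆ B, B'.card = Q ∧ ∀ b ∈ B',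
      ∃ (r : V) (R : G.Walk (σ b) r), IsInducedPath R ∧ walkVerts R ⊆ X b ∧
        G.Adj r (p.getVert j) ∧ (∀ w ∈ walkVerts R, Touches G w (walkVerts p) → w = r) ∧
        ∀ i, j < i → i ≤ p.length → ¬ G.Adj r (p.getVert i) := by
  obtain ⟨T, hT⟩ := exists_stable_bound t t
  obtain ⟨n, hn⟩ := exists_spread_or_last t T s Q
  refine ⟨n, ?_⟩
  intro V β G x B X σ hG hL y z p hp hxp hxp' hdisj htouch hB
  classical
  have hfirst : ∀ b : {b // b ∈ B}, ∃ (r : V) (R : G.Walk (σ b) r), IsInducedPath R ∧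
      walkVerts R ⊆ X b ∧ r ∈ {w | Touches G w (walkVerts p)} ∧
      ∀ w ∈ walkVerts R, w ∈ {w | Touches G w (walkVerts p)} → w = r := fun b =>
    exists_inducedPath_firstTouch (hL.conn b b.2) (hL.mem b b.2) (htouch b b.2)
  choose r R hR hRX hr honly using hfirst
  have hrX : ∀ b : {b // b ∈ B}, r b ∈ X b := fun b => hRX b (end_mem_walkVerts (R b))
  have hrr : ∀ b c : {b // b ∈ B}, b ≠ c → Anticomplete G {r b} {r c} := fun b c hbc =>
    (hL.anti b b.2 c c.2 (fun h => hbc (Subtype.ext h))).mono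
      (Set.singleton_subset_iff.2 (hrX b)) (Set.singleton_subset_iff.2 (hrX c))
  have hinj : Set.InjOn p.getVert {i | i ≤ p.length} := hp.1.getVert_injOn
  -- If `t` ends had `T` common neighbors on `p`, a stable set of `t` of these would give an induced
  -- `K_{t,t}`-minor with singletons as branch sets.
  have hno : ∀ U ⊆ B.attach, U.card = t → ∀ J : Finset ℕ,
      (∀ j ∈ J, j ≤ p.length ∧ ∀ b ∈ U, G.Adj (r b) (p.getVert j)) → J.card < T := by
    intro U _ hUc J hJ
    by_contra hlt
    obtain ⟨A, hAJ, hAc, hA⟩ := hT G J p.getVert hG.1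
      (hinj.mono (fun j hj => (hJ j hj).1)) (not_lt.1 hlt)
    refine hG.no_bipartite_finset hUc hAc (fun b => {r b}) (fun j => {p.getVert j})
      (fun _ _ => connSet_singleton _) (fun _ _ => connSet_singleton _)
      (fun b _ c _ hbc => hrr b c hbc) ?_ ?_ ?_
    · intro i hi j hj hij
      exact anticomplete_singleton
        (fun h => hij (hinj (hJ i (hAJ hi)).1 (hJ j (hAJ hj)).1 h)) (hA i hi j hj)
    · intro b _ j _
      rw [Set.disjoint_singleton]
      intro h
      exact Set.disjoint_left.1 (hdisj b b.2) (hrX b) (h ▸ p.getVert_mem_support j)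
    · intro b hb j hj
      exact ⟨_, rfl, _, rfl, (hJ j (hAJ hj)).2 b hb⟩
  have hpos : ∀ b ∈ B.attach, ∃ i ≤ p.length, G.Adj (r b) (p.getVert i) := by
    intro b _
    obtain ⟨w, hw, hbw⟩ := hr b
    obtain ⟨i, rfl, hi⟩ := mem_walkVerts_iff.1 hw
    exact ⟨i, hi, hbw⟩
  rcases hn B.attach (fun b i => G.Adj (r b) (p.getVert i)) p.length hno hpos
    (by simpa using hB) with
    ⟨j, hj, S', -, hc, hS1, hS2⟩ | ⟨j, hj, S', -, hc, hS1⟩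
  · left
    obtain ⟨e, he, heS, -⟩ := exists_fin_enum hc
    have hsub : walkVerts (p.drop j) ⊆ walkVerts p := by
      intro w hw
      obtain ⟨i, -, -, rfl⟩ := (mem_walkVerts_drop_iff hj).1 hw
      exact p.getVert_mem_support i
    -- The path of the dome is the final segment of `p` over which the chosen ends are spread.
    refine nonempty_dome hL (hp.drop j) (fun h => hxp (hsub h)) (fun w hw => hxp' w (hsub hw))
      (fun b hb => (hdisj b hb).mono_right hsub) (fun i => (e i : β))
      (Subtype.val_injective.comp he) (fun i => (e i).2) (fun i => r (e i)) (fun i => R (e i))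
      (fun i => hR _) (fun i => hRX _)
      (fun i w hw hw' => honly _ w hw (hw'.mono hsub)) ?_ ?_
    · intro i
      obtain ⟨k, h1, h2, h3⟩ := hS1 (e i) (heS i)
      exact ⟨_, (mem_walkVerts_drop_iff hj).2 ⟨k, h1, h2, rfl⟩, h3⟩
    · intro v hv
      obtain ⟨i, h1, h2, rfl⟩ := (mem_walkVerts_drop_iff hj).1 hv
      refine le_trans ?_ (hS2 i h1 h2)
      have : G.neighborSet (p.getVert i) ∩ Set.range (fun i => r (e i)) ⊆
          ((S'.filter (fun b => G.Adj (r b) (p.getVert i))).image r : Finset V) := by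
        rintro _ ⟨hw, k, rfl⟩
        rw [Finset.coe_image]
        exact ⟨e k, Finset.mem_coe.2 (Finset.mem_filter.2 ⟨heS k, hw.symm⟩), rfl⟩
      refine (Set.ncard_le_ncard this (Finset.finite_toSet _)).trans ?_
      rw [Set.ncard_coe_finset]
      exact Finset.card_image_le
  · right
    refine ⟨j, hj, S'.map (Function.Embedding.subtype _), ?_, by rw [Finset.card_map, hc], ?_⟩
    · intro b hb
      obtain ⟨b, -, rfl⟩ := Finset.mem_map.1 hb
      exact b.2
    · intro b hb
      obtain ⟨b, hbS, rfl⟩ := Finset.mem_map.1 hb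
      exact ⟨r b, R b, hR b, hRX b, (hS1 b hbS).1, honly b, (hS1 b hbS).2⟩

/-! ### Components of vertex sets -/

/-- The vertices joined to `e` inside `X`. -/
def comp (G : SimpleGraph V) (X : Set V) (e : V) : Set V := {u | Joined G X e u}

lemma mem_comp_self {X : Set V} {e : V} (he : e ∈ X) : e ∈ comp G X e := Joined.refl he

lemma comp_subset {X : Set V} {e : V} : comp G X e ⊆ X := fun _ h => h.right_mem

lemma mem_comp_of_adj {X : Set V} {e u v : V} (hu : u ∈ comp G X e) (hv : v ∈ X)
    (h : G.Adj u v) : v ∈ comp G X e :=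
  Joined.trans hu (Joined.of_adj hu.right_mem hv h)

lemma joined_comp {X : Set V} {e u : V} (h : u ∈ comp G X e) : Joined G (comp G X e) e u := by
  obtain ⟨p, hp⟩ := h
  exact ⟨p, fun w hw => ((joined_start_of_mem_walkVerts p hw).mono hp).symm⟩

lemma connSet_comp {X : Set V} {e : V} (he : e ∈ X) : ConnSet G (comp G X e) :=
  ConnSet.of_center (mem_comp_self he) fun _ h => (joined_comp h).symm

/-- The non-neighbors of `v` in `C`, without `v`. -/
def awayFrom (G : SimpleGraph V) (C : Set V) (v : V) : Set V := {u | u ∈ C ∧ u ≠ v ∧ ¬ G.Adj v u}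

/-- On a walk from `u` to `v` inside `C`, the first vertex that is not a non-neighbor of `v` is a
neighbor `w` of `v`, and `e` is the vertex before it. -/
lemma exists_exit {C : Set V} (hC : ConnSet G C) {u v : V} (hv : v ∈ C)
    (hu : u ∈ awayFrom G C v) :
    ∃ w e, w ∈ C ∧ G.Adj v w ∧ G.Adj w e ∧ e ∈ awayFrom G C v ∧ Joined G (awayFrom G C v) u e := by
  by_contra hcon
  have : v ∈ awayFrom G C v ∧ Joined G (awayFrom G C v) u v := by
    refine Joined.mem_of_closed (hC.2 u hu.1 v hv)
      (P := fun a => a ∈ awayFrom G C v ∧ Joined G (awayFrom G C v) u a)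
      ⟨hu, Joined.refl hu⟩ ?_
    rintro a b - hb hab ⟨ha, hua⟩
    have hbX : b ∈ awayFrom G C v := by
      refine ⟨hb, ?_, ?_⟩
      · rintro rfl
        exact ha.2.2 hab.symm
      · intro hvb
        exact hcon ⟨b, a, hb, hvb, hab.symm, ha, hua⟩
    exact ⟨hbX, hua.trans (Joined.of_adj ha hbX hab)⟩
  exact this.1.2.1 rfl

/-- The removed component contains neither `v` nor a neighbor of `v`, and by `exists_exit` every
other component is attached to such a neighbor. In `exists_branch` this provides a route from `v`
around the component. -/
lemma connSet_diff_comp {C : Set V} (hC : ConnSet G C) {v e : V} (hv : v ∈ C) :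
    ConnSet G (C \ comp G (awayFrom G C v) e) := by
  have hvE : v ∈ C \ comp G (awayFrom G C v) e := ⟨hv, fun h => (comp_subset h).2.1 rfl⟩
  have hnE : ∀ u ∈ C, G.Adj v u → u ∈ C \ comp G (awayFrom G C v) e := fun u hu hvu =>
    ⟨hu, fun h => (comp_subset h).2.2 hvu⟩
  refine ConnSet.of_center hvE ?_
  rintro u ⟨huC, huE⟩
  by_cases huv : u = v
  · subst huv
    exact Joined.refl hvE
  by_cases hadj : G.Adj v u
  · exact Joined.of_adj (hnE u huC hadj) hvE hadj.symm
  obtain ⟨w, e', hw, hvw, hwe', he', hj⟩ := exists_exit hC hv (u := u) ⟨huC, huv, hadj⟩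
  have h1 : Joined G (C \ comp G (awayFrom G C v) e) u e' := by
    refine (joined_comp hj).mono ?_
    intro a ha
    exact ⟨(comp_subset ha).1, fun h => huE (Joined.trans h (Joined.symm ha))⟩
  exact (h1.trans (Joined.of_adj h1.right_mem (hnE w hw hvw) hwe'.symm)).trans
    (Joined.of_adj (hnE w hw hvw) hvE hvw.symm)

/-! ### Connecting a stable set through a connected set -/

/-- There are an induced path in `C` starting at `v` and `N` pairwise anticomplete connected sets,
each touching the path and consisting of an element of `S` and vertices of `C` outside the path. -/
def HasComb (G : SimpleGraph V) (S : Finset V) (N : ℕ) (v : V) (C : Set V) : Prop :=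
  ∃ (u : V) (p : G.Walk v u) (σ : Fin N → V) (L : Fin N → Set V),
    IsInducedPath p ∧ walkVerts p ⊆ C ∧
    (∀ i, σ i ∈ S ∧ σ i ∈ L i ∧ L i ⊆ insert (σ i) C ∧ ConnSet G (L i) ∧
      Disjoint (L i) (walkVerts p) ∧ ∃ a ∈ L i, Touches G a (walkVerts p)) ∧
    ∀ i j, i ≠ j → Anticomplete G (L i) (L j)

lemma HasComb.of_finset {S : Finset V} {N : ℕ} {v : V} {C : Set V} {β : Type*} {B : Finset β}
    (hB : N ≤ B.card) {u : V} (p : G.Walk v u) (σ : β → V) (L : β → Set V) (hp : IsInducedPath p)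
    (hpC : walkVerts p ⊆ C)
    (h : ∀ b ∈ B, σ b ∈ S ∧ σ b ∈ L b ∧ L b ⊆ insert (σ b) C ∧ ConnSet G (L b) ∧
      Disjoint (L b) (walkVerts p) ∧ ∃ a ∈ L b, Touches G a (walkVerts p))
    (hanti : ∀ b ∈ B, ∀ c ∈ B, b ≠ c → Anticomplete G (L b) (L c)) : HasComb G S N v C := by
  obtain ⟨B', hB', hc⟩ := Finset.exists_subset_card_eq hB
  obtain ⟨e, he, heB, -⟩ := exists_fin_enum hc
  exact ⟨u, p, fun i => σ (e i), fun i => L (e i), hp, hpC, fun i => h _ (hB' (heB i)),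
    fun i j hij => hanti _ (hB' (heB i)) _ (hB' (heB j)) (he.ne hij)⟩

lemma HasComb.mono {S S' : Finset V} {N : ℕ} {v : V} {C C' : Set V} (h : HasComb G S N v C)
    (hS : S ⊆ S') (hC : C ⊆ C') : HasComb G S' N v C' := by
  obtain ⟨u, p, σ, L, h1, h2, h3, h4⟩ := h
  refine ⟨u, p, σ, L, h1, h2.trans hC, fun i => ?_, h4⟩
  obtain ⟨a1, a2, a3, a4⟩ := h3 i
  exact ⟨hS a1, a2, a3.trans (Set.insert_subset_insert hC), a4⟩

/-- The recursion descends from `C` into a smaller set `C'` in which `w` is the only neighbor of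
`v`; afterwards `v` is put in front of the path. The attached sets avoid `v` because they lie in `S
∪ C'`. -/
lemma HasComb.cons {S : Finset V} {N : ℕ} {v w : V} {C C' : Set V} (h : HasComb G S N w C')
    (hvS : v ∉ S) (hvC : v ∈ C) (hC : C' ⊆ C) (hv : v ∉ C') (hvw : G.Adj v w)
    (hn : ∀ u ∈ C', G.Adj v u → u = w) : HasComb G S N v C := by
  obtain ⟨u, p, σ, L, h1, h2, h3, h4⟩ := h
  refine ⟨u, Walk.cons hvw p, σ, L, h1.cons hvw (fun h => hv (h2 h)) (fun a ha => hn a (h2 ha)),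
    ?_, fun i => ?_, h4⟩
  · rw [walkVerts_cons]
    exact Set.insert_subset hvC (h2.trans hC)
  · obtain ⟨a1, a2, a3, a4, a5, a, ha, ha'⟩ := h3 i
    rw [walkVerts_cons]
    refine ⟨a1, a2, a3.trans (Set.insert_subset_insert hC), a4, ?_, a, ha,
      ha'.mono (Set.subset_insert _ _)⟩
    rw [Set.disjoint_insert_right]
    refine ⟨fun hvL => ?_, a5⟩
    rcases a3 hvL with h | h
    · exact hvS (h ▸ a1)
    · exact hv h

open scoped Classical in
-- The attached sets are the single elements of `S` that have a neighbor on the path.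
lemma HasComb.of_touches {S : Finset V} (hS : ∀ a ∈ S, ∀ b ∈ S, ¬ G.Adj a b) {N : ℕ} {v u : V}
    {C : Set V} (hSC : ∀ a ∈ S, a ∉ C) (p : G.Walk v u) (hp : IsInducedPath p)
    (hpC : walkVerts p ⊆ C) (hN : N ≤ (S.filter (fun s => Touches G s (walkVerts p))).card) :
    HasComb G S N v C := by
  refine HasComb.of_finset hN p id (fun s => {s}) hp hpC ?_ ?_
  · intro s hs
    obtain ⟨h1, h2⟩ := Finset.mem_filter.1 hs
    refine ⟨h1, rfl, by simp, connSet_singleton _, ?_, s, rfl, h2⟩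
    rw [Set.disjoint_singleton_left]
    exact fun h => hSC s h1 (hpC h)
  · intro a ha b hb hab
    exact anticomplete_singleton hab (hS a (Finset.mem_filter.1 ha).1 b (Finset.mem_filter.1 hb).1)

/-! ### Collecting branches under a degree bound -/

/-- A connected set `set` with an element `leaf`, and a vertex `port` that may have neighbors in the
sets recorded later. -/
structure Branch (V : Type*) where
  leaf : V
  set : Set V
  port : V

/-- An induced path in `C` starting at `v`, with a list of `h` disjoint branches touching it such
that each branch without its port is anticomplete to the later ones. -/
def HasBranches (G : SimpleGraph V) (S : Finset V) (h : ℕ) (v : V) (C : Set V) : Prop :=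
  ∃ (u : V) (p : G.Walk v u) (l : List (Branch V)),
    IsInducedPath p ∧ walkVerts p ⊆ C ∧ l.length = h ∧
    (∀ R ∈ l, R.leaf ∈ S ∧ R.leaf ∈ R.set ∧ R.set ⊆ insert R.leaf C ∧ ConnSet G R.set ∧
      Disjoint R.set (walkVerts p) ∧ (∃ a ∈ R.set, Touches G a (walkVerts p)) ∧ R.port ∈ C) ∧
    l.Pairwise (fun R R' => Disjoint R.set R'.set ∧ Anticomplete G (R.set \ {R.port}) R'.set)

lemma HasBranches.cons {S S' : Finset V} {h : ℕ} {v w : V} {C C' : Set V}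
    (hb : HasBranches G S' h w C') (hSS : S' ⊆ S)
    (hvS : v ∉ S) (hvC : v ∈ C) (hC : C' ⊆ C) (hv : v ∉ C') (hvw : G.Adj v w)
    (hn : ∀ u ∈ C', G.Adj v u → u = w) : HasBranches G S h v C := by
  obtain ⟨u, p, l, h1, h2, h3, h4, h5⟩ := hb
  refine ⟨u, Walk.cons hvw p, l, h1.cons hvw (fun h => hv (h2 h)) (fun a ha => hn a (h2 ha)),
    ?_, h3, fun R hR => ?_, h5⟩
  · rw [walkVerts_cons]
    exact Set.insert_subset hvC (h2.trans hC)
  · obtain ⟨a1, a2, a3, a4, a5, ⟨a, ha, ha'⟩, a6⟩ := h4 R hR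
    rw [walkVerts_cons]
    refine ⟨hSS a1, a2, a3.trans (Set.insert_subset_insert hC), a4, ?_, ⟨a, ha,
      ha'.mono (Set.subset_insert _ _)⟩, hC a6⟩
    rw [Set.disjoint_insert_right]
    refine ⟨fun hvL => ?_, a5⟩
    rcases a3 hvL with h | h
    · exact hvS (h ▸ hSS a1)
    · exact hv h

open scoped Classical in
/-- Long lists of branches contain many pairwise anticomplete branches. -/
lemma exists_branches_bound (D N : ℕ) : ∃ h : ℕ, ∀ {V : Type*} [Fintype V] {G : SimpleGraph V}
    {S : Finset V} {v : V} {H : Set V},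
    (∀ u ∈ H, (Finset.univ.filter (fun a => G.Adj u a ∧ (a ∈ H ∨ a ∈ S))).card < D) →
    HasBranches G S h v H → HasComb G S N v H := by
  obtain ⟨h, hh⟩ := exists_ramsey (D + 1) N
  refine ⟨h, fun {V} _ {G S v H} hdeg hb => ?_⟩
  obtain ⟨u, p, l, hp, hpH, hl, hbr, hpair⟩ := hb
  subst hl
  have hpair' := List.pairwise_iff_getElem.1 hpair
  rcases hh (SimpleGraph.fromRel
      (fun i j : Fin l.length => ¬ Anticomplete G (l[i]).set (l[j]).set)) Finset.univ (by simp) with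
    ⟨A, -, hA, hadj⟩ | ⟨A, -, hA, hadj⟩
  · exfalso
    have hne : A.Nonempty := Finset.card_pos.1 (by omega)
    -- The earliest branch of the clique is joined to the `D` others through its port only. These
    -- are disjoint, so the port would have `D` distinct neighbors, contrary to the degree bound.
    set i := A.min' hne with hi
    have hiA : i ∈ A := Finset.min'_mem _ _
    have key : ∀ j : Fin l.length, ∃ b, j ∈ A.erase i →
        b ∈ (l[j]).set ∧ G.Adj (l[i]).port b := by
      intro j
      by_cases hj : j ∈ A.erase i
      · obtain ⟨hji, hjA⟩ := Finset.mem_erase.1 hj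
        have hlt : i < j := lt_of_le_of_ne (Finset.min'_le _ _ hjA) (Ne.symm hji)
        obtain ⟨hd, ha⟩ := hpair' i j i.2 j.2 hlt
        have h1 := hadj i hiA j hjA (Ne.symm hji)
        rw [SimpleGraph.fromRel_adj] at h1
        have h2 : ¬ Anticomplete G (l[i]).set (l[j]).set := by
          rcases h1.2 with h | h
          · exact h
          · exact fun h' => h h'.symm
        unfold Anticomplete at h2
        push Not at h2
        obtain ⟨a, haL, b, hbL, hab⟩ := h2 hd
        refine ⟨b, fun _ => ⟨hbL, ?_⟩⟩
        by_cases hap : a = (l[i]).port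
        · rwa [← hap]
        · exact absurd hab (ha.2 a ⟨haL, hap⟩ b hbL)
      · exact ⟨v, fun h => absurd h hj⟩
    choose b hb using key
    have hcard : (A.erase i).card ≤ (Finset.univ.filter
        (fun a => G.Adj (l[i]).port a ∧ (a ∈ H ∨ a ∈ S))).card := by
      refine Finset.card_le_card_of_injOn b ?_ ?_
      · intro j hj
        have h1 := hb j hj
        have h2 := hbr (l[j]) (List.getElem_mem _)
        rw [Finset.mem_coe, Finset.mem_filter]
        refine ⟨Finset.mem_univ _, h1.2, ?_⟩
        rcases h2.2.2.1 h1.1 with h | h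
        · right; rw [h]; exact h2.1
        · exact Or.inl h
      · intro j hj k hk hjk
        by_contra hne'
        have h1 := (hb j hj).1
        have h2 := (hb k hk).1
        rw [hjk] at h1
        rcases lt_or_gt_of_ne hne' with hlt | hlt
        · exact Set.disjoint_left.1 (hpair' j k j.2 k.2 hlt).1 h1 h2
        · exact Set.disjoint_left.1 (hpair' k j k.2 j.2 hlt).1 h2 h1
    rw [Finset.card_erase_of_mem hiA, hA] at hcard
    have := hdeg _ (hbr (l[i]) (List.getElem_mem _)).2.2.2.2.2.2
    omega
  · refine HasComb.of_finset hA.ge p (fun i : Fin l.length => (l[i]).leaf)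
      (fun i => (l[i]).set) hp hpH ?_ ?_
    · intro i _
      obtain ⟨a1, a2, a3, a4, a5, a6, -⟩ := hbr (l[i]) (List.getElem_mem _)
      exact ⟨a1, a2, a3, a4, a5, a6⟩
    · intro i hi j hj hij
      have := hadj i hi j hj
      rw [SimpleGraph.fromRel_adj] at this
      push Not at this
      exact (this hij).1

/-- The size of a stable set that forces `h` branches. -/
def branchBound (D N : ℕ) : ℕ → ℕ
  | 0 => 0
  | h + 1 => D * D + D * (D * (branchBound D N h + N)) + 1

lemma HasBranches.zero {S : Finset V} {v : V} {C : Set V} (hv : v ∈ C) :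
    HasBranches G S 0 v C :=
  ⟨v, Walk.nil, [], isInducedPath_nil v, by rw [walkVerts_nil]; simpa using hv, rfl, by simp,
    List.Pairwise.nil⟩

open Finset in
open scoped Classical in
/-- Some component of the non-neighbors of `v` in `C` touches many elements of `S'`. -/
lemma exists_large_comp [Fintype V] {S S' : Finset V} {C H : Set V} {D m : ℕ} (hCH : C ⊆ H)
    (hdeg : ∀ u ∈ H, (univ.filter (fun a => G.Adj u a ∧ (a ∈ H ∨ a ∈ S))).card < D)
    (hS'S : S' ⊆ S)
    (hC : ConnSet G C) {v : V} (hv : v ∈ C) (hS' : ∀ s ∈ S', Touches G s C)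
    (hcard : D * D + D * (D * m) < S'.card) :
    ∃ w e, w ∈ C ∧ G.Adj v w ∧ G.Adj w e ∧ e ∈ awayFrom G C v ∧
      m ≤ (S'.filter (fun s => Touches G s (comp G (awayFrom G C v) e))).card := by
  by_contra hcon
  push Not at hcon
  set Nv := univ.filter (fun w => G.Adj v w ∧ w ∈ C) with hNv
  have hNvc : Nv.card < D := by
    refine lt_of_le_of_lt (card_le_card ?_) (hdeg v (hCH hv))
    intro w hw
    obtain ⟨-, h1, h2⟩ := mem_filter.1 hw
    exact mem_filter.2 ⟨mem_univ _, h1, Or.inl (hCH h2)⟩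
  -- The elements of `S'` are counted by where they touch `C`. At most `D * D` touch the closed
  -- neighborhood of `v`. The others touch a component reached through one of at most `D * D` pairs
  -- `w, e`, and by assumption each component is touched by fewer than `m`.
  have hsub : S' ⊆ ((insert v Nv).biUnion (fun w => S'.filter (fun s => G.Adj w s))) ∪
      Nv.biUnion (fun w => (univ.filter (fun e => G.Adj w e ∧ e ∈ awayFrom G C v)).biUnion
        (fun e => S'.filter (fun s => Touches G s (comp G (awayFrom G C v) e)))) := by
    intro s hs
    obtain ⟨u, hu, hsu⟩ := hS' s hs
    rw [mem_union]
    by_cases huv : u = v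
    · left
      subst huv
      exact mem_biUnion.2 ⟨u, mem_insert_self _ _, mem_filter.2 ⟨hs, hsu.symm⟩⟩
    by_cases hvu : G.Adj v u
    · left
      exact mem_biUnion.2 ⟨u, mem_insert_of_mem (mem_filter.2 ⟨mem_univ _, hvu, hu⟩),
        mem_filter.2 ⟨hs, hsu.symm⟩⟩
    right
    obtain ⟨w, e, hw, hvw, hwe, he, hj⟩ := exists_exit hC hv (u := u) ⟨hu, huv, hvu⟩
    refine mem_biUnion.2 ⟨w, mem_filter.2 ⟨mem_univ _, hvw, hw⟩, mem_biUnion.2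
      ⟨e, mem_filter.2 ⟨mem_univ _, hwe, he⟩, mem_filter.2 ⟨hs, u, hj.symm, hsu⟩⟩⟩
  have h1 : ((insert v Nv).biUnion (fun w => S'.filter (fun s => G.Adj w s))).card ≤ D * D := by
    refine (card_biUnion_le_card_mul _ _ D ?_).trans (Nat.mul_le_mul_right _ ?_)
    · intro w hw
      have hwH : w ∈ H := by
        rcases mem_insert.1 hw with rfl | hw
        · exact hCH hv
        · exact hCH (mem_filter.1 hw).2.2
      refine (lt_of_le_of_lt (card_le_card ?_) (hdeg w hwH)).le
      intro s hs
      obtain ⟨h1, h2⟩ := mem_filter.1 hs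
      exact mem_filter.2 ⟨mem_univ _, h2, Or.inr (hS'S h1)⟩
    · exact (card_insert_le _ _).trans hNvc
  have h2 : (Nv.biUnion (fun w => (univ.filter (fun e => G.Adj w e ∧ e ∈ awayFrom G C v)).biUnion
        (fun e => S'.filter (fun s => Touches G s (comp G (awayFrom G C v) e))))).card
      ≤ D * (D * m) := by
    refine (card_biUnion_le_card_mul _ _ (D * m) ?_).trans (Nat.mul_le_mul_right _ hNvc.le)
    intro w hw
    obtain ⟨-, hvw, hwC⟩ := mem_filter.1 hw
    refine (card_biUnion_le_card_mul _ _ m ?_).trans (Nat.mul_le_mul_right _ ?_)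
    · intro e he
      obtain ⟨-, hwe, he'⟩ := mem_filter.1 he
      exact (hcon w e hwC hvw hwe he').le
    · refine (lt_of_le_of_lt (card_le_card ?_) (hdeg w (hCH hwC))).le
      intro e he
      obtain ⟨-, hwe, he'⟩ := mem_filter.1 he
      exact mem_filter.2 ⟨mem_univ _, hwe, Or.inl (hCH he'.1)⟩
  have h3 := (card_le_card hsub).trans (card_union_le _ _)
  omega

open scoped Classical in
/-- A vertex `s₀` touching `C` but not the component `E` gives a branch that is anticomplete to
`E` and to all but few elements of `S`, except for its port. -/
lemma exists_branch {S : Finset V} (hS : ∀ a ∈ S, ∀ b ∈ S, ¬ G.Adj a b) {C : Set V} {N : ℕ}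
    (hSC : ∀ s ∈ S, s ∉ C) (hC : ConnSet G C) {v w e : V} (hv : v ∈ C) (hw : w ∈ C)
    (hvw : G.Adj v w) {s₀ : V} (hs₀ : s₀ ∈ S) (hs₀C : Touches G s₀ C)
    (hs₀E : ¬ Touches G s₀ (comp G (awayFrom G C v) e)) :
    HasComb G S N v C ∨ ∃ Q : Set V, (S.filter (fun s => Touches G s Q)).card < N ∧
      ∃ L : Set V, ∃ r ∈ C, s₀ ∈ L ∧ L ⊆ insert s₀ Q ∧ L ⊆ insert s₀ C ∧ ConnSet G L ∧
        v ∉ L ∧ w ∉ L ∧ (∀ a ∈ L, a ∉ comp G (awayFrom G C v) e) ∧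
        (∃ a ∈ L, G.Adj a v ∨ G.Adj a w) ∧
        ∀ a ∈ L, a ≠ r → ∀ b ∈ comp G (awayFrom G C v) e, ¬ G.Adj a b := by
  set E := comp G (awayFrom G C v) e with hE
  have hvE : v ∉ E := fun h => (comp_subset h).2.1 rfl
  have hs₀notC := hSC s₀ hs₀
  obtain ⟨u, huC, hsu⟩ := hs₀C
  -- The path `q` leads from `v` around `E` to a neighbor of `s₀`. If it touches `N` elements of
  -- `S`, these form a comb with it; otherwise the branch is cut out of `s₀` and `q`.
  obtain ⟨r', q, hq, hqC, hr', -⟩ := exists_inducedPath_firstTouch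
    (connSet_diff_comp (e := e) hC hv) (a := v) ⟨hv, hvE⟩ (T := {u | G.Adj s₀ u})
    ⟨u, ⟨huC, fun h => hs₀E ⟨u, h, hsu⟩⟩, hsu⟩
  by_cases hN : N ≤ (S.filter (fun s => Touches G s (walkVerts q))).card
  · exact Or.inl (HasComb.of_touches hS hSC q hq (hqC.trans Set.sdiff_subset) hN)
  right
  refine ⟨walkVerts q, not_le.1 hN, ?_⟩
  have hXconn : ConnSet G (insert s₀ (walkVerts q)) :=
    (connSet_walkVerts q).insert ⟨r', end_mem_walkVerts q, hr'⟩
  -- Back from `s₀`, the path `R` stops at its first vertex `r` in `C` that is `v` or a neighbor of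
  -- `v`; only this vertex, the port, may have neighbors in `E`. Requiring membership in `C` keeps
  -- `R` from stopping at `s₀` itself.
  obtain ⟨r, R, hR, hRX, hrT, honly⟩ := exists_inducedPath_firstTouch hXconn
    (Set.mem_insert _ _) (T := {a | a ∈ C ∧ (a = v ∨ G.Adj v a)})
    ⟨v, Set.mem_insert_of_mem _ (start_mem_walkVerts q), hv, Or.inl rfl⟩
  have hs₀v : s₀ ≠ v := fun h => hs₀notC (h ▸ hv)
  have hs₀w : s₀ ≠ w := fun h => hs₀notC (h ▸ hw)
  have hs₀r : s₀ ≠ r := fun h => hs₀notC (h ▸ hrT.1)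
  have hRC : ∀ a ∈ walkVerts R, a ≠ s₀ → a ∈ C ∧ a ∉ E := by
    intro a ha has
    rcases hRX ha with h | h
    · exact absurd h has
    · exact hqC h
  have hwR : ∀ a ∈ walkVerts R, a = w → r = w := fun a ha haw => by
    subst haw
    exact (honly a ha ⟨hw, Or.inr hvw⟩).symm
  have hvR : ∀ a ∈ walkVerts R, a = v → r = v := fun a ha hav => by
    subst hav
    exact (honly a ha ⟨hv, Or.inl rfl⟩).symm
  -- Both `v` and `w` belong to the target, so either can only be the last vertex of `R`. Deleting
  -- them leaves a connected set with a vertex adjacent to `v` or `w`.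
  have hLconn : ConnSet G (walkVerts R \ {v, w}) ∧
      ∃ a ∈ walkVerts R \ {v, w}, G.Adj a v ∨ G.Adj a w := by
    obtain ⟨h1, a, ha, har⟩ := connSet_walkVerts_diff_end hR.1 hs₀r
    by_cases hrv : r = v
    · have : walkVerts R \ {v, w} = walkVerts R \ {r} := by
        ext a
        simp only [Set.mem_sdiff, Set.mem_insert_iff, Set.mem_singleton_iff, not_or]
        exact ⟨fun h => ⟨h.1, hrv ▸ h.2.1⟩, fun h => ⟨h.1, hrv ▸ h.2,
          fun h' => h.2 (h'.trans (hwR a h.1 h').symm)⟩⟩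
      rw [this]
      exact ⟨h1, a, ha, Or.inl (hrv ▸ har)⟩
    by_cases hrw : r = w
    · have : walkVerts R \ {v, w} = walkVerts R \ {r} := by
        ext a
        simp only [Set.mem_sdiff, Set.mem_insert_iff, Set.mem_singleton_iff, not_or]
        exact ⟨fun h => ⟨h.1, hrw ▸ h.2.2⟩, fun h => ⟨h.1,
          fun h' => h.2 (h'.trans (hvR a h.1 h').symm), hrw ▸ h.2⟩⟩
      rw [this]
      exact ⟨h1, a, ha, Or.inr (hrw ▸ har)⟩
    · have : walkVerts R \ {v, w} = walkVerts R := by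
        ext a
        simp only [Set.mem_sdiff, Set.mem_insert_iff, Set.mem_singleton_iff, not_or]
        exact ⟨fun h => h.1, fun h => ⟨h, fun h' => hrv (hvR a h h'), fun h' => hrw (hwR a h h')⟩⟩
      rw [this]
      refine ⟨connSet_walkVerts R, r, end_mem_walkVerts R, Or.inl ?_⟩
      rcases hrT.2 with h | h
      · exact absurd h hrv
      · exact h.symm
  refine ⟨walkVerts R \ {v, w}, r, hrT.1, ⟨start_mem_walkVerts R, by simp [hs₀v, hs₀w]⟩,
    fun a ha => hRX ha.1, ?_, hLconn.1, by simp, by simp, ?_, hLconn.2, ?_⟩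
  · intro a ha
    by_cases has : a = s₀
    · exact Or.inl has
    · exact Or.inr (hRC a ha.1 has).1
  · intro a ha haE
    by_cases has : a = s₀
    · exact hs₀notC (has ▸ (comp_subset haE).1)
    · exact (hRC a ha.1 has).2 haE
  · intro a ha har b hb hab
    by_cases has : a = s₀
    · exact hs₀E ⟨b, hb, has ▸ hab⟩
    · obtain ⟨haC, haE⟩ := hRC a ha.1 has
      -- Before `r`, vertices of `R` in `C` are non-neighbors of `v` outside `E`, so they have no
      -- edge to the component `E`.
      have haX : a ∈ awayFrom G C v := by
        refine ⟨haC, fun h => har ?_, fun h => har ?_⟩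
        · exact honly a ha.1 ⟨haC, Or.inl h⟩
        · exact honly a ha.1 ⟨haC, Or.inr h⟩
      exact haE (mem_comp_of_adj hb haX hab.symm)

open scoped Classical in
/-- Under a degree bound, large stable sets touching a connected set yield many branches. -/
lemma hasComb_or_hasBranches [Fintype V] {S : Finset V} {H : Set V} {D N : ℕ}
    (hS : ∀ a ∈ S, ∀ b ∈ S, ¬ G.Adj a b) (hSH : ∀ s ∈ S, s ∉ H)
    (hdeg : ∀ u ∈ H, (Finset.univ.filter (fun a => G.Adj u a ∧ (a ∈ H ∨ a ∈ S))).card < D)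
    (n : ℕ) : ∀ (h : ℕ) (S' : Finset V) (C : Set V) (v : V), C.ncard = n → C ⊆ H →
      ConnSet G C → v ∈ C → S' ⊆ S → (∀ s ∈ S', Touches G s C) → branchBound D N h ≤ S'.card →
      HasComb G S N v C ∨ HasBranches G S' h v C := by
  induction n using Nat.strong_induction_on with
  | _ n ih =>
  intro h S' C v hn hCH hC hv hS'S hS'C hcard
  rcases h with _ | h
  · exact Or.inr (HasBranches.zero hv)
  have hSC : ∀ s ∈ S, s ∉ C := fun s hs hsC => hSH s hs (hCH hsC)
  have hvS : v ∉ S := fun h => hSC v h hv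
  -- The summand `N` pays for the elements touching `Q`, which are discarded below.
  obtain ⟨w, e, hwC, hvw, hwe, he, hm⟩ := exists_large_comp (D := D) (m := branchBound D N h + N) hCH hdeg
    hS'S hC hv hS'C (by simp only [branchBound] at hcard; omega)
  set E := comp G (awayFrom G C v) e with hE
  have hEC : E ⊆ C := fun a ha => (comp_subset ha).1
  have hC'C : insert w E ⊆ C := Set.insert_subset hwC hEC
  have hvE : v ∉ E := fun h => (comp_subset h).2.1 rfl
  have hvC' : v ∉ insert w E := by
    rintro (h | h)
    · exact hvw.ne h
    · exact hvE h
  have hC'conn : ConnSet G (insert w E) := (connSet_comp he).insert ⟨e, mem_comp_self he, hwe⟩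
  have hn' : ∀ u ∈ insert w E, G.Adj v u → u = w := by
    rintro u (h | h) hvu
    · exact h
    · exact absurd hvu (comp_subset h).2.2
  have hlt : (insert w E).ncard < n := by
    rw [← hn]
    exact Set.ncard_lt_ncard ⟨hC'C, fun h => hvC' (h hv)⟩
  -- If all of `S'` touches `E`, nothing is recorded and the recursion continues in the smaller set
  -- with the same `h`. Otherwise an element that does not touch `E` supplies a branch.
  by_cases hall : ∀ s ∈ S', Touches G s E
  · rcases ih _ hlt (h + 1) S' (insert w E) w rfl (hC'C.trans hCH) hC'conn (Set.mem_insert _ _)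
      hS'S (fun s hs => (hall s hs).mono (Set.subset_insert _ _)) hcard with h1 | h1
    · exact Or.inl (h1.cons hvS hv hC'C hvC' hvw hn')
    · exact Or.inr (h1.cons subset_rfl (fun h => hvS (hS'S h)) hv hC'C hvC' hvw hn')
  push Not at hall
  obtain ⟨s₀, hs₀, hs₀E⟩ := hall
  rcases exists_branch (N := N) hS hSC hC hv hwC hvw (hS'S hs₀) (hS'C s₀ hs₀) hs₀E with
    h1 | ⟨Q, hQ, L, r, hrC, hsL, hLQ, hLC, hLconn, hvL, hwL, hLE, hLt, hLa⟩
  · exact Or.inl h1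
  -- Later leaves touch `E` but not `Q`. As the new branch lies in `insert s₀ Q` and `S` is stable,
  -- it has no edge to any of them.
  set S'' := (S'.filter (fun s => Touches G s E)).filter (fun s => ¬ Touches G s Q) with hS''
  have hS''S' : S'' ⊆ S' := (Finset.filter_subset _ _).trans (Finset.filter_subset _ _)
  have hcard'' : branchBound D N h ≤ S''.card := by
    have h1 : ((S'.filter (fun s => Touches G s E)).filter (fun s => Touches G s Q)).card +
        S''.card = (S'.filter (fun s => Touches G s E)).card := by
      convert Finset.card_filter_add_card_filter_not (fun s => Touches G s Q)
    have h2 : ((S'.filter (fun s => Touches G s E)).filter (fun s => Touches G s Q)).card ≤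
        (S.filter (fun s => Touches G s Q)).card :=
      Finset.card_le_card (Finset.filter_subset_filter _
        ((Finset.filter_subset _ _).trans hS'S))
    omega
  rcases ih _ hlt h S'' (insert w E) w rfl (hC'C.trans hCH) hC'conn (Set.mem_insert _ _)
      (hS''S'.trans hS'S) (fun s hs => (Finset.mem_filter.1 (Finset.mem_filter.1 hs).1).2.mono
        (Set.subset_insert _ _)) hcard'' with h1 | h1
  · exact Or.inl (h1.cons hvS hv hC'C hvC' hvw hn')
  right
  obtain ⟨u, p, l, hp, hpC, hl, hbr, hpair⟩ := h1
  have hwp : w ∈ walkVerts p := start_mem_walkVerts p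
  have hset : ∀ R ∈ l, ∀ b ∈ R.set, b = R.leaf ∨ b ∈ E := by
    intro R hR b hb
    obtain ⟨-, -, a3, -, a5, -⟩ := hbr R hR
    rcases a3 hb with h | h | h
    · exact Or.inl h
    · exact absurd (h ▸ hb) (fun hw => Set.disjoint_left.1 a5 hw hwp)
    · exact Or.inr h
  have hleaf : ∀ R ∈ l, R.leaf ∈ S ∧ Touches G R.leaf E ∧ ¬ Touches G R.leaf Q := by
    intro R hR
    have h1 := Finset.mem_filter.1 (hbr R hR).1
    exact ⟨hS'S (hS''S' (hbr R hR).1), (Finset.mem_filter.1 h1.1).2, h1.2⟩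
  have hdis : ∀ R ∈ l, Disjoint L R.set := by
    intro R hR
    rw [Set.disjoint_left]
    intro b hbL hbR
    rcases hset R hR b hbR with h | h
    · subst h
      rcases hLC hbL with h | h
      · exact hs₀E (h ▸ (hleaf R hR).2.1)
      · exact hSC _ (hleaf R hR).1 h
    · exact hLE b hbL h
  refine ⟨u, Walk.cons hvw p, ⟨s₀, L, r⟩ :: l, hp.cons hvw (fun h => hvC' (hpC h))
    (fun a ha => hn' a (hpC ha)), ?_, by simp [hl], ?_, ?_⟩
  · rw [walkVerts_cons]
    exact Set.insert_subset hv (hpC.trans hC'C)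
  · intro R hR
    rw [walkVerts_cons]
    rcases List.mem_cons.1 hR with rfl | hR
    · refine ⟨hs₀, hsL, hLC, hLconn, ?_, ?_, hrC⟩
      · rw [Set.disjoint_left]
        rintro a ha (h | h)
        · exact hvL (h ▸ ha)
        · rcases hpC h with h' | h'
          · exact hwL (h' ▸ ha)
          · exact hLE a ha h'
      · obtain ⟨a, ha, h | h⟩ := hLt
        · exact ⟨a, ha, v, Set.mem_insert _ _, h⟩
        · exact ⟨a, ha, w, Set.mem_insert_of_mem _ hwp, h⟩
    · obtain ⟨a1, a2, a3, a4, a5, ⟨a, ha, ha'⟩, a6⟩ := hbr R hR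
      refine ⟨hS''S' a1, a2, a3.trans (Set.insert_subset_insert hC'C), a4, ?_,
        ⟨a, ha, ha'.mono (Set.subset_insert _ _)⟩, hC'C a6⟩
      rw [Set.disjoint_insert_right]
      refine ⟨fun hvR => ?_, a5⟩
      rcases hset R hR v hvR with h | h
      · exact hvS (h ▸ (hleaf R hR).1)
      · exact hvE h
  · refine List.pairwise_cons.2 ⟨fun R hR => ⟨hdis R hR, (hdis R hR).mono_left Set.sdiff_subset,
      ?_⟩, hpair⟩
    rintro a ⟨haL, har⟩ b hb hab
    rcases hset R hR b hb with h | h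
    · subst h
      rcases hLQ haL with h | h
      · exact hS s₀ (hS'S hs₀) _ (hleaf R hR).1 (h ▸ hab)
      · exact (hleaf R hR).2.2 ⟨a, h, hab.symm⟩
    · exact hLa a haL har b h hab

/-! ### Minimal connecting sets -/

lemma IsInducedPath.eq_of_adj_start {a b u w : V} {p : G.Walk a b} (hp : IsInducedPath p)
    (hu : u ∈ walkVerts p) (hw : w ∈ walkVerts p) (hau : G.Adj a u) (haw : G.Adj a w) : u = w := by
  cases p with
  | nil =>
    rw [walkVerts_nil] at hu
    exact absurd hu.symm hau.ne
  | cons h q =>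
    obtain ⟨-, -, hn⟩ := (isInducedPath_cons_iff h q).1 hp
    rw [walkVerts_cons] at hu hw
    rcases hu with hu | hu
    · exact absurd hu.symm hau.ne
    rcases hw with hw | hw
    · exact absurd hw.symm haw.ne
    rw [hn u hu hau, hn w hw haw]

/-- The part of a connected set `H` cut off from `v` by a neighbor `w` of `v`, including `w`. -/
lemma connSet_cutOff {H : Set V} (hH : ConnSet G H) {v w : V} (hw : w ∈ H) :
    ConnSet G (H \ comp G (H \ {w}) v) := by
  have hwD : w ∈ H \ comp G (H \ {w}) v := ⟨hw, fun h => (comp_subset h).2 rfl⟩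
  refine ConnSet.of_center hwD fun u hu => ?_
  by_contra hcon
  refine hcon (Joined.mem_of_closed (hH.2 u hu.1 w hw)
    (P := fun a => Joined G (H \ comp G (H \ {w}) v) u a) (Joined.refl hu) ?_)
  intro a b ha hb hab hua
  by_cases hbK : b ∈ comp G (H \ {w}) v
  · by_cases haw : a = w
    · exact absurd (haw ▸ hua) hcon
    · exact absurd (mem_comp_of_adj hbK (v := a) ⟨ha, haw⟩ hab.symm) hua.right_mem.2
  · exact hua.trans (Joined.of_adj hua.right_mem ⟨hb, hbK⟩ hab)

/-- The part cut off by `w` is connected and avoids `w'`, which is adjacent to `v`. A vertex in both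
parts could therefore reach `w`, and then `v`, without meeting `w'`, a contradiction. By the same
token an edge between the two parts could only be `w w'`. -/
lemma anticomplete_cutOff {H : Set V} (hH : ConnSet G H) {v w w' : V} (hv : v ∈ H) (hw : w ∈ H)
    (hw' : w' ∈ H) (hvw : G.Adj v w) (hvw' : G.Adj v w') (hne : w ≠ w') (hadj : ¬ G.Adj w w') :
    Anticomplete G (H \ comp G (H \ {w}) v) (H \ comp G (H \ {w'}) v) := by
  have hmem : ∀ a b : V, a ∈ H → b ∈ H → G.Adj v a → G.Adj v b → a ≠ b →
      b ∈ comp G (H \ {a}) v := fun a b ha hb hva hvb hab =>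
    mem_comp_of_adj (mem_comp_self ⟨hv, hva.ne⟩) ⟨hb, fun h => hab (Eq.symm h)⟩ hvb
  have hdisj : ∀ u, u ∈ H \ comp G (H \ {w}) v → u ∈ H \ comp G (H \ {w'}) v → False := by
    intro u hu hu'
    have h1 : Joined G (H \ {w'}) u w := by
      refine ((connSet_cutOff hH hw).2 u hu w ⟨hw, fun h => (comp_subset h).2 rfl⟩).mono ?_
      rintro a ⟨haH, haK⟩
      refine ⟨haH, fun h => haK ?_⟩
      rw [Set.mem_singleton_iff] at h
      rw [h]
      exact hmem w w' hw hw' hvw hvw' hne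
    exact hu'.2 (Joined.trans (hmem w' w hw' hw hvw' hvw hne.symm) h1.symm)
  refine ⟨Set.disjoint_left.2 fun u hu hu' => hdisj u hu hu', ?_⟩
  intro u hu u' hu' huu'
  have h1 : u = w := by
    by_contra hne'
    have : u' ∈ comp G (H \ {w}) v := by
      by_contra h
      exact hdisj u' ⟨hu'.1, h⟩ hu'
    exact hu.2 (mem_comp_of_adj this ⟨hu.1, hne'⟩ huu'.symm)
  have h2 : u' = w' := by
    by_contra hne'
    have : u ∈ comp G (H \ {w'}) v := by
      by_contra h
      exact hdisj u hu ⟨hu.1, h⟩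
    exact hu'.2 (mem_comp_of_adj this ⟨hu'.1, hne'⟩ huu')
  exact hadj (h1 ▸ h2 ▸ huu')

/-- If `H` is minimal among the connected sets that contain `z` and touch all of `S`, then a vertex
of large degree in `H` yields a comb. -/
lemma hasComb_of_stable_neighbors {S : Finset V} (hS : ∀ a ∈ S, ∀ b ∈ S, ¬ G.Adj a b) {H : Set V}
    (hSH : ∀ s ∈ S, s ∉ H) (hH : ConnSet G H) {z : V} (hz : z ∈ H)
    (htouch : ∀ s ∈ S, Touches G s H)
    (hmin : ∀ K ⊆ H, K ≠ H → ConnSet G K → z ∈ K → ∃ s ∈ S, ¬ Touches G s K) {N : ℕ} {v : V}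
    (hv : v ∈ H) {W : Finset V} (hW : ∀ w ∈ W, w ∈ H ∧ G.Adj v w)
    (hWW : ∀ w ∈ W, ∀ w' ∈ W, ¬ G.Adj w w') (hN : N + 1 ≤ W.card) : HasComb G S N z H := by
  classical
  obtain ⟨p, hp, hpH⟩ := exists_inducedPath hH hz hv
  have hpK : ∀ w, w ∉ walkVerts p → ∀ a ∈ walkVerts p, a ∈ comp G (H \ {w}) v := by
    intro w hw a ha
    have h1 : Joined G (walkVerts p) v a :=
      (connSet_walkVerts p).2 v (end_mem_walkVerts p) a ha
    exact h1.mono fun b hb => ⟨hpH hb, fun h => hw (by rw [← Set.mem_singleton_iff.1 h]; exact hb)⟩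
  have hex : ∀ w, ∃ s, w ∈ W → w ∉ walkVerts p →
      s ∈ S ∧ ¬ Touches G s (comp G (H \ {w}) v) := by
    intro w
    by_cases h : w ∈ W ∧ w ∉ walkVerts p
    · obtain ⟨s, hs⟩ := hmin (comp G (H \ {w}) v) (fun a ha => (comp_subset ha).1)
        (fun h' => (comp_subset (h'.symm ▸ (hW w h.1).1 : w ∈ comp G (H \ {w}) v)).2 rfl)
        (connSet_comp ⟨hv, (hW w h.1).2.ne⟩) (hpK w h.2 z (start_mem_walkVerts p))
      exact ⟨s, fun _ _ => hs⟩
    · exact ⟨z, fun h1 h2 => absurd ⟨h1, h2⟩ h⟩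
  choose s hs using hex
  set D : V → Set V := fun w => H \ comp G (H \ {w}) v with hD
  have hwD : ∀ w ∈ W, w ∈ D w := fun w hw => ⟨(hW w hw).1, fun h => (comp_subset h).2 rfl⟩
  set W' := W.filter (fun w => w ∉ walkVerts p) with hW'
  have hsD : ∀ w ∈ W', Touches G (s w) (D w) := by
    intro w hw
    obtain ⟨h1, h2⟩ := Finset.mem_filter.1 hw
    obtain ⟨h3, h4⟩ := hs w h1 h2
    obtain ⟨b, hb, hsb⟩ := htouch _ h3
    exact ⟨b, ⟨hb, fun h => h4 ⟨b, h, hsb⟩⟩, hsb⟩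
  have hanti : ∀ w ∈ W', ∀ w' ∈ W', w ≠ w' → Anticomplete G (D w) (D w') := by
    intro w hw w' hw' hne
    have h1 := (Finset.mem_filter.1 hw).1
    have h2 := (Finset.mem_filter.1 hw').1
    exact anticomplete_cutOff hH hv (hW w h1).1 (hW w' h2).1 (hW w h1).2 (hW w' h2).2 hne
      (hWW w h1 w' h2)
  have hsD' : ∀ w ∈ W', ∀ w' ∈ W', w ≠ w' → ¬ Touches G (s w) (D w') := by
    rintro w hw w' hw' hne ⟨b, hb, hsb⟩
    obtain ⟨h1, h2⟩ := Finset.mem_filter.1 hw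
    refine (hs w h1 h2).2 ⟨b, ?_, hsb⟩
    by_contra hbK
    exact Set.disjoint_left.1 (hanti w hw w' hw' hne).1 ⟨hb.1, hbK⟩ hb
  have hsS : ∀ w ∈ W', s w ∈ S := fun w hw =>
    (hs w (Finset.mem_filter.1 hw).1 (Finset.mem_filter.1 hw).2).1
  have hcard : N ≤ W'.card := by
    -- An induced path ending in `v` contains at most one neighbor of `v`; this explains `N + 1`.
    have h1 : (W.filter (fun w => w ∈ walkVerts p)).card ≤ 1 := by
      rw [Finset.card_le_one]
      intro a ha b hb
      obtain ⟨ha1, ha2⟩ := Finset.mem_filter.1 ha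
      obtain ⟨hb1, hb2⟩ := Finset.mem_filter.1 hb
      rw [← walkVerts_reverse] at ha2 hb2
      exact hp.reverse.eq_of_adj_start ha2 hb2 (hW a ha1).2 (hW b hb1).2
    have h2 : (W.filter (fun w => w ∈ walkVerts p)).card + W'.card = W.card := by
      convert Finset.card_filter_add_card_filter_not (fun w => w ∈ walkVerts p)
    omega
  refine HasComb.of_finset hcard p s (fun w => insert (s w) (D w)) hp hpH ?_ ?_
  · intro w hw
    obtain ⟨h1, h2⟩ := Finset.mem_filter.1 hw
    refine ⟨hsS w hw, Set.mem_insert _ _, Set.insert_subset_insert Set.sdiff_subset,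
      (connSet_cutOff hH (hW w h1).1).insert (hsD w hw), ?_, w,
      Set.mem_insert_of_mem _ (hwD w h1), v, end_mem_walkVerts p, (hW w h1).2.symm⟩
    rw [Set.disjoint_left]
    rintro a (ha | ha) hap
    · exact hSH _ (hsS w hw) (hpH (ha ▸ hap))
    · exact ha.2 (hpK w h2 a hap)
  · intro w hw w' hw' hne
    have hsne : s w ≠ s w' := fun h => hsD' w hw w' hw' hne (h ▸ hsD w' hw')
    constructor
    · rw [Set.disjoint_left]
      rintro a (ha | ha) (ha' | ha')
      · exact hsne (ha.symm.trans ha')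
      · exact hSH _ (hsS w hw) (ha ▸ ha'.1)
      · exact hSH _ (hsS w' hw') (ha' ▸ ha.1)
      · exact Set.disjoint_left.1 (hanti w hw w' hw' hne).1 ha ha'
    · rintro a (ha | ha) b (hb | hb) hab
      · exact hS _ (hsS w hw) _ (hsS w' hw') (ha ▸ hb ▸ hab)
      · exact hsD' w hw w' hw' hne ⟨b, hb, ha ▸ hab⟩
      · exact hsD' w' hw' w hw hne.symm ⟨a, ha, hb ▸ hab.symm⟩
      · exact (hanti w hw w' hw' hne).2 a ha b hb hab

/-- In a graph of bounded clique number, a large stable set whose elements all touch a connected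
set `H` yields a comb. -/
theorem exists_comb_bound (t N : ℕ) : ∃ n : ℕ, ∀ {V : Type*} [Finite V] {G : SimpleGraph V},
    G.CliqueFree (t + 1) → ∀ {S : Finset V} {H : Set V} {z : V},
    (∀ a ∈ S, ∀ b ∈ S, ¬ G.Adj a b) → (∀ s ∈ S, s ∉ H) → ConnSet G H → z ∈ H →
    (∀ s ∈ S, Touches G s H) → n ≤ S.card → HasComb G S N z H := by
  classical
  obtain ⟨d, hd⟩ := exists_stable_bound t (N + 1)
  obtain ⟨h, hh⟩ := exists_branches_bound (d + N) N
  refine ⟨branchBound (d + N) N h, ?_⟩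
  intro V _ G hG S H₁ z hS hSH₁ hH₁ hz₁ htouch₁ hcard
  have := Fintype.ofFinite V
  -- In a minimal connected set through `z` touching all of `S`, a vertex of large degree yields a
  -- comb at once. If there is none, branches can be collected under a degree bound.
  obtain ⟨H, ⟨hHH₁, hH, hz, htouch⟩, hmin'⟩ := (measure (Set.ncard (α := V))).wf.has_min
    {H | H ⊆ H₁ ∧ ConnSet G H ∧ z ∈ H ∧ ∀ s ∈ S, Touches G s H}
    ⟨H₁, subset_rfl, hH₁, hz₁, htouch₁⟩
  have hSH : ∀ s ∈ S, s ∉ H := fun s hs h => hSH₁ s hs (hHH₁ h)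
  have hmin : ∀ K ⊆ H, K ≠ H → ConnSet G K → z ∈ K → ∃ s ∈ S, ¬ Touches G s K := by
    intro K hK hne hKc hzK
    by_contra hcon
    push Not at hcon
    exact hmin' K ⟨hK.trans hHH₁, hKc, hzK, hcon⟩
      (Set.ncard_lt_ncard (hK.ssubset_of_ne hne))
  suffices h' : HasComb G S N z H from h'.mono subset_rfl hHH₁
  by_contra hcon
  -- Among `d` neighbors in `H` there would be `N + 1` stable ones, and `N` neighbors in `S` would
  -- form a comb with a path from `z`.
  have hdeg : ∀ u ∈ H, (Finset.univ.filter (fun a => G.Adj u a ∧ (a ∈ H ∨ a ∈ S))).card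
      < d + N := by
    intro u hu
    have h1 : (Finset.univ.filter (fun a => G.Adj u a ∧ a ∈ H)).card < d := by
      by_contra hlt
      obtain ⟨W, hW, hWc, hWW⟩ := hd G (Finset.univ.filter (fun a => G.Adj u a ∧ a ∈ H)) id hG
        (Function.injective_id.injOn) (not_lt.1 hlt)
      refine hcon (hasComb_of_stable_neighbors hS hSH hH hz htouch hmin hu (W := W) ?_ hWW hWc.ge)
      intro w hw
      have := (Finset.mem_filter.1 (hW hw)).2
      exact ⟨this.2, this.1⟩
    have h2 : (S.filter (fun s => G.Adj u s)).card < N := by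
      by_contra hlt
      obtain ⟨p, hp, hpH⟩ := exists_inducedPath hH hz hu
      refine hcon (HasComb.of_touches hS hSH p hp hpH ((not_lt.1 hlt).trans ?_))
      refine Finset.card_le_card fun s hs => ?_
      obtain ⟨hs1, hs2⟩ := Finset.mem_filter.1 hs
      exact Finset.mem_filter.2 ⟨hs1, u, end_mem_walkVerts p, hs2.symm⟩
    have h3 : (Finset.univ.filter (fun a => G.Adj u a ∧ (a ∈ H ∨ a ∈ S))).card ≤
        ((Finset.univ.filter (fun a => G.Adj u a ∧ a ∈ H)) ∪
          (S.filter (fun s => G.Adj u s))).card := by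
      refine Finset.card_le_card fun a ha => ?_
      obtain ⟨-, h1, h2 | h2⟩ := Finset.mem_filter.1 ha
      · exact Finset.mem_union_left _ (Finset.mem_filter.2 ⟨Finset.mem_univ _, h1, h2⟩)
      · exact Finset.mem_union_right _ (Finset.mem_filter.2 ⟨h2, h1⟩)
    have h4 := h3.trans (Finset.card_union_le _ _)
    omega
  rcases hasComb_or_hasBranches hS hSH hdeg _ h S H z rfl subset_rfl hH hz subset_rfl htouch
    hcard with h1 | h1
  · exact hcon h1
  · exact hcon (hh hdeg h1)

/-! ### Bananas and thetas -/

lemma IsInducedPath.length_eq_one {x y : V} {p : G.Walk x y} (hp : IsInducedPath p)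
    (h : G.Adj x y) : p.length = 1 := by
  have h1 := (hp.adj_getVert_iff (i := 0) (j := p.length) (Nat.zero_le _) le_rfl).1 (by simpa using h)
  omega

/-- Between adjacent vertices the edge is the only induced path, while the paths of a banana are
distinct. -/
lemma Banana.not_adj {x y : V} {q : ℕ} (B : Banana G x y q) (hq : 2 ≤ q) : ¬ G.Adj x y := by
  intro h
  have key : ∀ p q : G.Walk x y, p.length = 1 → q.length = 1 → p = q := by
    intro p q hp hq
    apply Walk.ext_getVert
    intro k
    rcases k with _ | k
    · simp
    · rw [Walk.getVert_of_length_le _ (by omega), Walk.getVert_of_length_le _ (by omega)]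
  have h1 := B.path_injective (key (B.path ⟨0, by omega⟩) (B.path ⟨1, by omega⟩)
    ((B.isInducedPath _).length_eq_one h) ((B.isInducedPath _).length_eq_one h))
  simp at h1

lemma IsInducedPath.two_le_length {x y : V} {p : G.Walk x y} (hne : x ≠ y) (h : ¬ G.Adj x y) :
    2 ≤ p.length := by
  by_contra hlt
  have h0 : p.length = 0 ∨ p.length = 1 := by omega
  rcases h0 with h0 | h0
  · exact hne (Walk.eq_of_length_eq_zero h0)
  · exact h (Walk.adj_of_length_eq_one h0)

/-- The banana formed by some of the paths of a banana. -/
def Banana.restrict {x y : V} {q m : ℕ} (B : Banana G x y q) (e : Fin m → Fin q)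
    (he : Function.Injective e) : Banana G x y m where
  ends_ne := B.ends_ne
  path i := B.path (e i)
  isInducedPath i := B.isInducedPath (e i)
  path_injective := B.path_injective.comp he
  internally_disjoint _ _ hij := B.internally_disjoint _ _ (he.ne hij)

lemma Banana.restrict_verts_subset {x y : V} {q m : ℕ} (B : Banana G x y q) (e : Fin m → Fin q)
    (he : Function.Injective e) : (B.restrict e he).verts ⊆ B.verts :=
  Set.iUnion_subset fun i => Set.subset_iUnion (fun i => walkVerts (B.path i)) (e i)

/-- Anticomplete legs at `x` whose last vertices are adjacent to `y` form a theta. -/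
lemma exists_theta {β : Type*} {x y : V} {B : Finset β} {X : β → Set V} {σ : β → V}
    (hL : IsLegs G x B X σ) {m : ℕ} (e : Fin m → β) (he : Function.Injective e)
    (heB : ∀ i, e i ∈ B) (hxy : x ≠ y) (hadj : ¬ G.Adj x y) (hy : ∀ i, y ∉ X (e i))
    (r : Fin m → V) (R : ∀ i, G.Walk (σ (e i)) (r i)) (hR : ∀ i, IsInducedPath (R i))
    (hRX : ∀ i, walkVerts (R i) ⊆ X (e i)) (hry : ∀ i, G.Adj (r i) y)
    (honly : ∀ i, ∀ w ∈ walkVerts (R i), G.Adj w y → w = r i) :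
    ∃ T : Banana G x y m, T.IsTheta ∧ ∀ i, walkVerts (T.path i) = {x, y} ∪ walkVerts (R i) := by
  have hverts : ∀ i, walkVerts ((Walk.cons (hL.adj _ (heB i)) (R i)).concat (hry i)) =
      {x, y} ∪ walkVerts (R i) := by
    intro i
    rw [walkVerts_concat, walkVerts_cons]
    ext w
    simp only [Set.mem_insert_iff, Set.mem_union, Set.mem_singleton_iff]
    tauto
  have hint : ∀ i, pathInterior ((Walk.cons (hL.adj _ (heB i)) (R i)).concat (hry i)) =
      walkVerts (R i) := by
    intro i
    unfold pathInterior
    rw [hverts]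
    ext w
    simp only [Set.mem_sdiff, Set.mem_union]
    constructor
    · rintro ⟨h | h, h'⟩
      · exact absurd h h'
      · exact h
    · intro h
      refine ⟨Or.inr h, ?_⟩
      rintro (h' | h')
      · exact hL.notMem _ (heB i) (hRX i (h' ▸ h))
      · rw [Set.mem_singleton_iff] at h'
        exact hy i (hRX i (h' ▸ h))
  have hanti : ∀ i j, i ≠ j → Anticomplete G (walkVerts (R i)) (walkVerts (R j)) := fun i j hij =>
    (hL.anti _ (heB i) _ (heB j) (he.ne hij)).mono (hRX i) (hRX j)
  refine ⟨⟨hxy, fun i => (Walk.cons (hL.adj _ (heB i)) (R i)).concat (hry i), ?_, ?_, ?_⟩, ?_,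
    hverts⟩
  · intro i
    refine IsInducedPath.concat ((hR i).cons _ (fun h => hL.notMem _ (heB i) (hRX i h))
      (fun w hw hxw => hL.only _ (heB i) w (hRX i hw) hxw)) _ ?_ ?_
    · rw [walkVerts_cons]
      rintro (h | h)
      · exact hxy h.symm
      · exact hy i (hRX i h)
    · rw [walkVerts_cons]
      rintro w (h | h) hyw
      · exact absurd (h ▸ hyw.symm) hadj
      · exact honly i w h hyw.symm
  · intro i j hij
    by_contra hne
    have h1 := congrArg pathInterior hij
    simp only [hint] at h1
    exact Set.disjoint_left.1 (hanti i j hne).1 (start_mem_walkVerts (R i))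
      (h1 ▸ start_mem_walkVerts (R i))
  · intro i j hij
    rw [hint, hint]
    exact (hanti i j hij).1
  · intro i j hij
    rw [hint, hint]
    exact hanti i j hij

/-- The second vertex of a path is an inner vertex because `x` and `z` are not adjacent, so it lies
on no other path. This separates the neighbors of `x` from the rest of the banana. -/
lemma mem_legs_of_banana {x z : V} {q : ℕ} (B : Banana G x z q) (hq : 2 ≤ q) {i j : Fin q} {k : ℕ}
    (hk : 1 ≤ k) (hkl : k ≤ (B.path i).length) (h : (B.path i).getVert k = (B.path j).getVert 1) :
    i = j ∧ k = 1 := by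
  have hij : i = j := by
    by_contra hij
    have hlen := IsInducedPath.two_le_length (p := B.path j) B.ends_ne (B.not_adj hq)
    have h1 : (B.path j).getVert 1 ≠ x := fun h' => by
      have := ((B.isInducedPath j).1.getVert_eq_start_iff (by omega)).1 h'
      omega
    have h2 : (B.path j).getVert 1 ≠ z := fun h' => by
      have := ((B.isInducedPath j).1.getVert_eq_end_iff (by omega)).1 h'
      omega
    have h3 : (B.path j).getVert 1 ∈ pathInterior (B.path i) :=
      ⟨h ▸ (B.path i).getVert_mem_support k, by simp [h1, h2]⟩
    exact Set.disjoint_left.1 (B.internally_disjoint i j hij) h3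
      ⟨(B.path j).getVert_mem_support 1, by simp [h1, h2]⟩
  subst hij
  refine ⟨rfl, (B.isInducedPath i).1.getVert_injOn hkl ?_ h⟩
  exact (hk.trans hkl : 1 ≤ _)

/-- A large dense banana in a tidy graph yields a dome or a tailed theta. -/
theorem exists_dome_or_tailedTheta (t s Q l : ℕ) : ∃ n : ℕ, ∀ {V : Type*} [Finite V]
    {G : SimpleGraph V} {x z : V}, IsTidy G t → ∀ {m : ℕ} (B : Banana G x z m), n ≤ m →
    B.IsDense l → Nonempty (Dome G x s t) ∨ ∃ T : TailedTheta G x z Q, T.verts ⊆ B.verts := by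
  -- Enough legs at the hub for either case: an `l`-theta if the hub is `z`, a `Q`-theta otherwise.
  obtain ⟨N, hN⟩ := exists_dome_or_hub t s (Q + l)
  obtain ⟨n₁, hn₁⟩ := exists_comb_bound t N
  obtain ⟨n₂, hn₂⟩ := exists_stable_bound t n₁
  -- At least two paths, so that `x` and `z` are not adjacent.
  refine ⟨n₂ + 2, ?_⟩
  intro V _ G x z hG m B hm hdense
  classical
  have hm2 : 2 ≤ m := by omega
  have hxz := B.not_adj hm2
  have hlen : ∀ i, 2 ≤ (B.path i).length := fun i => IsInducedPath.two_le_length B.ends_ne hxz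
  set f : Fin m → V := fun i => (B.path i).getVert 1 with hf
  have hfinj : Function.Injective f := by
    intro i j hij
    exact (mem_legs_of_banana B hm2 le_rfl (by have := hlen i; omega) hij).1
  obtain ⟨A, -, hAc, hA⟩ := hn₂ G Finset.univ f hG.1 hfinj.injOn (by simp; omega)
  -- The banana beyond the neighbors of `x`: connected through `z` and anticomplete to `x`.
  set H : Set V := insert z (⋃ i, walkVerts ((B.path i).drop 2)) with hH
  have hHB : H ⊆ B.verts := by
    rintro w (hw | hw)
    · exact Set.mem_iUnion.2 ⟨⟨0, by omega⟩, by rw [hw]; exact end_mem_walkVerts _⟩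
    · obtain ⟨i, hi⟩ := Set.mem_iUnion.1 hw
      obtain ⟨k, -, -, rfl⟩ := (mem_walkVerts_drop_iff (hlen i)).1 hi
      exact Set.mem_iUnion.2 ⟨i, (B.path i).getVert_mem_support k⟩
  have hHmem : ∀ w ∈ H, ∃ i k, 2 ≤ k ∧ k ≤ (B.path i).length ∧ (B.path i).getVert k = w := by
    rintro w (hw | hw)
    · exact ⟨⟨0, by omega⟩, _, hlen _, le_rfl, by rw [hw]; simp⟩
    · obtain ⟨i, hi⟩ := Set.mem_iUnion.1 hw
      obtain ⟨k, h1, h2, h3⟩ := (mem_walkVerts_drop_iff (hlen i)).1 hi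
      exact ⟨i, k, h1, h2, h3⟩
  have hHconn : ConnSet G H := by
    refine ConnSet.of_center (a := z) (Set.mem_insert _ _) ?_
    rintro w (hw | hw)
    · rw [hw]; exact Joined.refl (Set.mem_insert _ _)
    · obtain ⟨i, hi⟩ := Set.mem_iUnion.1 hw
      exact ((connSet_walkVerts _).2 w hi z (end_mem_walkVerts _)).mono
        ((Set.subset_iUnion (fun i => walkVerts ((B.path i).drop 2)) i).trans
          (Set.subset_insert _ _))
  have hxf : ∀ i, G.Adj x (f i) := by
    intro i
    have := (B.path i).adj_getVert_succ (i := 0) (by have := hlen i; omega)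
    simpa using this
  have hxH : x ∉ H := by
    intro hx
    obtain ⟨i, k, h1, h2, h3⟩ := hHmem x hx
    have := ((B.isInducedPath i).1.getVert_eq_start_iff h2).1 h3
    omega
  have hxH' : ∀ w ∈ H, ¬ G.Adj x w := by
    intro w hw hxw
    obtain ⟨i, k, h1, h2, rfl⟩ := hHmem w hw
    have := ((B.isInducedPath i).adj_getVert_iff (i := 0) (Nat.zero_le _) h2).1 (by simpa using hxw)
    omega
  have hfH : ∀ i, f i ∉ H := by
    intro i hi
    obtain ⟨j, k, h1, h2, h3⟩ := hHmem _ hi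
    have := (mem_legs_of_banana B hm2 (by omega) h2 h3).2
    omega
  have hfT : ∀ i, Touches G (f i) H := by
    intro i
    refine ⟨(B.path i).getVert 2, Set.mem_insert_of_mem _ (Set.mem_iUnion.2 ⟨i, ?_⟩), ?_⟩
    · exact start_mem_walkVerts _
    · exact (B.path i).adj_getVert_succ (i := 1) (by have := hlen i; omega)
  have hS : ∀ a ∈ A.image f, ∃ i ∈ A, f i = a := fun a ha => Finset.mem_image.1 ha
  obtain ⟨u, p, σ, L, hp, hpH, hL, hLL⟩ := hn₁ hG.1 (S := A.image f) (H := H) (z := z)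
    (by
      intro a ha b hb
      obtain ⟨i, hi, rfl⟩ := hS a ha
      obtain ⟨j, hj, rfl⟩ := hS b hb
      exact hA i hi j hj)
    (by
      intro a ha
      obtain ⟨i, -, rfl⟩ := hS a ha
      exact hfH i)
    hHconn (Set.mem_insert _ _)
    (by
      intro a ha
      obtain ⟨i, -, rfl⟩ := hS a ha
      exact hfT i)
    (by rw [Finset.card_image_of_injective _ hfinj, hAc])
  have hσ : ∀ i, ∃ k, f k = σ i := fun i => by
    obtain ⟨k, -, hk⟩ := hS _ (hL i).1
    exact ⟨k, hk⟩
  have hlegs : IsLegs G x Finset.univ L σ :=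
    { conn := fun i _ => (hL i).2.2.2.1
      mem := fun i _ => (hL i).2.1
      adj := fun i _ => by
        obtain ⟨k, hk⟩ := hσ i
        exact hk ▸ hxf k
      only := fun i _ w hw hxw => by
        rcases (hL i).2.2.1 hw with h | h
        · exact h
        · exact absurd hxw (hxH' w h)
      notMem := fun i _ hx => by
        rcases (hL i).2.2.1 hx with h | h
        · obtain ⟨k, hk⟩ := hσ i
          exact (hxf k).ne (h.trans hk.symm)
        · exact hxH h
      anti := fun i _ j _ hij => hLL i j hij }
  have hLB : ∀ i, L i ⊆ B.verts := by
    intro i w hw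
    rcases (hL i).2.2.1 hw with h | h
    · obtain ⟨k, hk⟩ := hσ i
      rw [h, ← hk]
      exact Set.mem_iUnion.2 ⟨k, (B.path k).getVert_mem_support 1⟩
    · exact hHB h
  have hxB : x ∈ B.verts := Set.mem_iUnion.2 ⟨⟨0, by omega⟩, start_mem_walkVerts _⟩
  have hpr : ∀ w ∈ walkVerts p.reverse, w ∈ H := fun w hw => hpH (walkVerts_reverse p ▸ hw)
  -- The comb's path starts at `z`; reversed, its part after the hub is a tail ending in `z`.
  rcases hN hG hlegs p.reverse hp.reverse (fun h => hxH (hpr x h)) (fun w hw => hxH' w (hpr w hw))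
    (fun i _ => by rw [walkVerts_reverse]; exact (hL i).2.2.2.2.1)
    (fun i _ => by rw [walkVerts_reverse]; exact (hL i).2.2.2.2.2) (by simp) with
    h | ⟨j, hj, B', -, hB'c, hB'⟩
  · exact Or.inl h
  right
  have hB'ex : ∀ b : {b // b ∈ B'}, _ := fun b => hB' b.1 b.2
  choose r R hR hRX hry honly hlast using hB'ex
  obtain ⟨e, he, heB, -⟩ := exists_fin_enum (S := B'.attach) (n := Q + l) (by simpa using hB'c)
  set y := p.reverse.getVert j with hy
  have hyp : y ∈ walkVerts p.reverse := p.reverse.getVert_mem_support j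
  have theta : ∀ {m : ℕ} (g : Fin m → Fin (Q + l)), Function.Injective g →
      ∃ T : Banana G x y m, T.IsTheta ∧
        ∀ i, walkVerts (T.path i) = {x, y} ∪ walkVerts (R (e (g i))) := by
    intro m g hg
    refine exists_theta hlegs (fun i => (e (g i)).1)
      (Subtype.val_injective.comp (he.comp hg)) (fun i => Finset.mem_univ _)
      (fun h => hxH (h ▸ hpr y hyp)) (hxH' y (hpr y hyp)) ?_ (fun i => r (e (g i)))
      (fun i => R (e (g i))) (fun i => hR _) (fun i => hRX _) (fun i => hry _)
      (fun i w hw hwy => honly _ w hw ⟨y, hyp, hwy⟩)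
    intro i hi
    refine Set.disjoint_left.1 (hL (e (g i)).1).2.2.2.2.1 hi ?_
    rw [← walkVerts_reverse]
    exact hyp
  have hverts : ∀ {m : ℕ} (g : Fin m → Fin (Q + l)) (T : Banana G x y m),
      (∀ i, walkVerts (T.path i) = {x, y} ∪ walkVerts (R (e (g i)))) → T.verts ⊆ B.verts := by
    intro m g T hT w hw
    obtain ⟨i, hi⟩ := Set.mem_iUnion.1 hw
    rw [hT] at hi
    rcases hi with (hi | hi) | hi
    · rw [hi]; exact hxB
    · rw [Set.mem_singleton_iff.1 hi]; exact hHB (hpr y hyp)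
    · exact hLB _ (hRX _ hi)
  by_cases hyz : y = z
  · exfalso
    obtain ⟨T, hT, hTv⟩ := theta (Fin.natAdd Q) (Fin.natAdd_injective _ _)
    have hTB := hverts _ T hTv
    clear_value y
    subst hyz
    exact hdense ⟨T, hT, hTB⟩
  · obtain ⟨T, hT, hTv⟩ := theta (Fin.castAdd l) (Fin.castAdd_injective _ _)
    have hTB := hverts _ T hTv
    refine ⟨⟨y, B.ends_ne, hyz, T, hT, p.reverse.drop j, hp.reverse.drop j, ?_⟩, ?_⟩
    · have htail : ∀ w ∈ walkVerts (p.reverse.drop j) \ {y},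
          ∃ i, j < i ∧ i ≤ p.reverse.length ∧ p.reverse.getVert i = w := by
        rintro w ⟨hw, hwy⟩
        obtain ⟨i, h1, h2, h3⟩ := (mem_walkVerts_drop_iff hj).1 hw
        refine ⟨i, lt_of_le_of_ne h1 ?_, h2, h3⟩
        rintro rfl
        exact hwy h3.symm
      have hTmem : ∀ w ∈ T.verts \ {y}, w = x ∨ ∃ b, w ∈ walkVerts (R b) := by
        rintro w ⟨hw, hwy⟩
        obtain ⟨i, hi⟩ := Set.mem_iUnion.1 hw
        rw [hTv] at hi
        rcases hi with (hi | hi) | hi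
        · exact Or.inl hi
        · exact absurd hi hwy
        · exact Or.inr ⟨_, hi⟩
      constructor
      · rw [Set.disjoint_left]
        intro w hw hwT
        obtain ⟨i, h1, h2, rfl⟩ := htail w hw
        have hwp : p.reverse.getVert i ∈ walkVerts p.reverse := p.reverse.getVert_mem_support i
        rcases hTmem _ hwT with h | ⟨b, hb⟩
        · exact hxH (h ▸ hpr _ hwp)
        · refine Set.disjoint_left.1 (hL b.1).2.2.2.2.1 (hRX b hb) ?_
          rw [← walkVerts_reverse]
          exact hwp
      · intro w hw a ha hwa
        obtain ⟨i, h1, h2, rfl⟩ := htail w hw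
        have hwp : p.reverse.getVert i ∈ walkVerts p.reverse := p.reverse.getVert_mem_support i
        rcases hTmem _ ha with rfl | ⟨b, hb⟩
        · exact hxH' _ (hpr _ hwp) hwa.symm
        · have := honly b a hb ⟨_, hwp, hwa.symm⟩
          subst this
          exact hlast b i h1 h2 hwa.symm
    · rintro w (hw | hw)
      · exact hTB hw
      · obtain ⟨i, -, -, rfl⟩ := (mem_walkVerts_drop_iff hj).1 hw
        exact hHB (hpr _ (p.reverse.getVert_mem_support i))

/-! ### Legs touching many paths -/

/-- The paths are treated one at a time by `exists_dome_or_hub`, each time keeping only legs that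
share a neighbor on the current path. The vertices `h i` are to form one side of an induced
`K_{t,t}`-minor. -/
lemma exists_dome_or_hubs (t s r m : ℕ) : ∃ n : ℕ, ∀ {V β ι : Type*} {G : SimpleGraph V} {x z : V}
    {B : Finset β} {X : β → Set V} {σ : β → V}, IsTidy G t → IsLegs G x B X σ →
    ∀ {y : ι → V} (p : ∀ i, G.Walk (y i) z) (I : Finset ι), (∀ i ∈ I, IsInducedPath (p i)) →
    (∀ i ∈ I, x ∉ walkVerts (p i)) → (∀ i ∈ I, ∀ w ∈ walkVerts (p i), ¬ G.Adj x w) →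
    (∀ i ∈ I, ∀ b ∈ B, Disjoint (X b) (walkVerts (p i))) →
    (∀ i ∈ I, ∀ b ∈ B, ∃ a ∈ X b, Touches G a (walkVerts (p i))) → I.card = r → n ≤ B.card →
    Nonempty (Dome G x s t) ∨ ∃ h : ι → V, ∃ B' ⊆ B, B'.card = m ∧ ∀ i ∈ I,
      h i ∈ walkVerts (p i) ∧ ∀ b ∈ B', ∃ a ∈ X b, G.Adj a (h i) := by
  induction r with
  | zero =>
    refine ⟨m, ?_⟩
    intro V β ι G x z B X σ hG hL y p I _ _ _ _ _ hI hB
    obtain ⟨B', hB', hc⟩ := Finset.exists_subset_card_eq hB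
    rw [Finset.card_eq_zero] at hI
    subst hI
    exact Or.inr ⟨y, B', hB', hc, by simp⟩
  | succ r ih =>
    obtain ⟨n, hn⟩ := ih
    obtain ⟨n', hn'⟩ := exists_dome_or_hub t s n
    refine ⟨n', ?_⟩
    intro V β ι G x z B X σ hG hL y p I hp hxp hxp' hdisj htouch hI hB
    classical
    obtain ⟨i, I', hi, rfl, hI'⟩ := Finset.card_eq_succ.1 hI
    have hii : i ∈ insert i I' := Finset.mem_insert_self _ _
    have hsub : ∀ j ∈ I', j ∈ insert i I' := fun j hj => Finset.mem_insert_of_mem hj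
    rcases hn' hG hL (p i) (hp i hii) (hxp i hii) (hxp' i hii) (hdisj i hii) (htouch i hii) hB with
      h | ⟨j, -, B₁, hB₁, hB₁c, hhub⟩
    · exact Or.inl h
    rcases hn hG (hL.mono hB₁) p I' (fun j hj => hp j (hsub j hj)) (fun j hj => hxp j (hsub j hj))
      (fun j hj => hxp' j (hsub j hj)) (fun j hj b hb => hdisj j (hsub j hj) b (hB₁ hb))
      (fun j hj b hb => htouch j (hsub j hj) b (hB₁ hb)) hI' hB₁c.ge with
      h | ⟨h, B', hB', hB'c, hh⟩
    · exact Or.inl h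
    refine Or.inr ⟨Function.update h i ((p i).getVert j), B', hB'.trans hB₁, hB'c, ?_⟩
    intro k hk
    rcases Finset.mem_insert.1 hk with rfl | hk
    · rw [Function.update_self]
      refine ⟨(p k).getVert_mem_support j, fun b hb => ?_⟩
      obtain ⟨r, R, -, hRX, hr, -⟩ := hhub b (hB' hb)
      exact ⟨r, hRX (end_mem_walkVerts R), hr⟩
    · rw [Function.update_of_ne (show k ≠ i from fun h' => hi (h' ▸ hk))]
      exact hh k hk

/-- In a tidy graph, if many legs at `x` touch all of many induced paths to `z` that are disjoint
except for `z`, then there is a dome with root `x`. -/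
lemma exists_dome_of_common_paths (t s : ℕ) (ht : 0 < t) : ∃ M n : ℕ, ∀ {V β ι : Type*}
    {G : SimpleGraph V} {x z : V}
    {B : Finset β} {X : β → Set V} {σ : β → V}, IsTidy G t → IsLegs G x B X σ →
    ∀ {y : ι → V} (p : ∀ i, G.Walk (y i) z) (I : Finset ι), (∀ i ∈ I, IsInducedPath (p i)) →
    (∀ i ∈ I, x ∉ walkVerts (p i)) → (∀ i ∈ I, ∀ w ∈ walkVerts (p i), ¬ G.Adj x w) →
    (∀ i ∈ I, ∀ b ∈ B, Disjoint (X b) (walkVerts (p i))) →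
    (∀ i ∈ I, ∀ b ∈ B, ∃ a ∈ X b, Touches G a (walkVerts (p i))) →
    (∀ i ∈ I, ∀ j ∈ I, i ≠ j → ∀ w ∈ walkVerts (p i), w ∈ walkVerts (p j) → w = z) →
    (∀ b ∈ B, ∀ a ∈ X b, ¬ G.Adj a z) → M ≤ I.card → n ≤ B.card →
    Nonempty (Dome G x s t) := by
  obtain ⟨M, hM⟩ := exists_stable_bound t t
  obtain ⟨n, hn⟩ := exists_dome_or_hubs t s M t
  refine ⟨M, n, ?_⟩
  intro V β ι G x z B X σ hG hL y p I₀ hp hxp hxp' hdisj htouch hpp hz hI₀ hB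
  obtain ⟨I, hII₀, hI⟩ := Finset.exists_subset_card_eq hI₀
  rcases hn hG hL p I (fun i hi => hp i (hII₀ hi)) (fun i hi => hxp i (hII₀ hi))
    (fun i hi => hxp' i (hII₀ hi)) (fun i hi => hdisj i (hII₀ hi))
    (fun i hi => htouch i (hII₀ hi)) hI hB with h | ⟨h, B', hB', hB'c, hh⟩
  · exact h
  exfalso
  obtain ⟨b₀, hb₀⟩ : B'.Nonempty := Finset.card_pos.1 (by omega)
  -- Two of the paths meet only in `z`, and no leg has an edge to `z`, so the hubs are distinct.
  have hinj : Set.InjOn h I := by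
    intro i hi j hj hij
    by_contra hne
    have h1 := hpp i (hII₀ hi) j (hII₀ hj) hne (h i) (hh i hi).1 (hij ▸ (hh j hj).1)
    obtain ⟨a, ha, hai⟩ := (hh i hi).2 b₀ hb₀
    exact hz b₀ (hB' hb₀) a ha (h1 ▸ hai)
  obtain ⟨A, hAI, hAc, hA⟩ := hM G I h hG.1 hinj hI.ge
  refine hG.no_bipartite_finset hB'c hAc X (fun i => {h i}) (fun b hb => hL.conn b (hB' hb))
    (fun _ _ => connSet_singleton _) (fun b hb c hc hbc => hL.anti b (hB' hb) c (hB' hc) hbc)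
    ?_ ?_ ?_
  · intro i hi j hj hij
    exact anticomplete_singleton (fun h' => hij (hinj (hAI hi) (hAI hj) h')) (hA i hi j hj)
  · intro b hb i hi
    rw [Set.disjoint_singleton_right]
    exact fun h' => Set.disjoint_left.1 (hdisj i (hII₀ (hAI hi)) b (hB' hb)) h' (hh i (hAI hi)).1
  · intro b hb i hi
    obtain ⟨a, ha, hai⟩ := (hh i (hAI hi)).2 b hb
    exact ⟨a, ha, _, rfl, hai⟩

/-! ### Selecting unrelated subfamilies -/

/-- In several large parts, between which there is no complete bipartite relation with sides of
size `t`, one can choose `q` elements of each part without relations between different parts. -/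
lemma exists_unrelated (t q k : ℕ) : ∃ n : ℕ, ∀ {ι β : Type*} (I : Finset ι) (B : ι → Finset β)
    (rel : ι → β → ι → β → Prop), I.card = k → (∀ i a j b, rel i a j b → rel j b i a) →
    (∀ i ∈ I, ∀ j ∈ I, i ≠ j → ∀ U ⊆ B i, ∀ W ⊆ B j, U.card = t → W.card = t →
      ¬ ∀ a ∈ U, ∀ b ∈ W, rel i a j b) → (∀ i ∈ I, n ≤ (B i).card) →
    ∃ B' : ι → Finset β, (∀ i ∈ I, B' i ⊆ B i ∧ (B' i).card = q) ∧
      ∀ i ∈ I, ∀ j ∈ I, i ≠ j → ∀ a ∈ B' i, ∀ b ∈ B' j, ¬ rel i a j b := by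
  classical
  induction k with
  | zero =>
    refine ⟨0, fun I B rel hI _ _ _ => ?_⟩
    rw [Finset.card_eq_zero] at hI
    subst hI
    exact ⟨B, by simp, by simp⟩
  | succ k ih =>
    obtain ⟨n, hn⟩ := ih
    -- From one part a set `X₀` of size `k * t + q` is kept, and in each of the other `k` parts a
    -- class of at least `n + t` elements with the same trace on `X₀`. A trace has at most `t`
    -- elements, since otherwise `t` of them would be complete to `t` elements of the class.
    -- Deleting all `k` traces leaves `q` elements of `X₀`.
    refine ⟨(k * t + q) + 2 ^ (k * t + q) * (n + t), ?_⟩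
    intro ι β I B rel hI hsymm hno hB
    obtain ⟨i₀, I', hi₀, rfl, hI'⟩ := Finset.card_eq_succ.1 hI
    have hi₀I : i₀ ∈ insert i₀ I' := Finset.mem_insert_self _ _
    have hsub : ∀ j ∈ I', j ∈ insert i₀ I' := fun j hj => Finset.mem_insert_of_mem hj
    obtain ⟨X₀, hX₀, hX₀c⟩ := Finset.exists_subset_card_eq
      (le_trans (Nat.le_add_right _ _) (hB i₀ hi₀I))
    have hpig : ∀ j, ∃ Z, j ∈ I' → Z ⊆ X₀ ∧
        n + t ≤ ((B j).filter (fun b => X₀.filter (fun a => rel i₀ a j b) = Z)).card := by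
      intro j
      by_cases hj : j ∈ I'
      · obtain ⟨Z, hZ, hZc⟩ := Finset.exists_le_card_fiber_of_mul_le_card_of_maps_to
          (s := B j) (t := X₀.powerset) (f := fun b => X₀.filter (fun a => rel i₀ a j b))
          (n := n + t) (fun b _ => Finset.mem_powerset.2 (Finset.filter_subset _ _))
          ⟨∅, by simp⟩ (by
            rw [Finset.card_powerset, hX₀c]
            exact le_trans (Nat.le_add_left _ _) (hB j (hsub j hj)))
        exact ⟨Z, fun _ => ⟨Finset.mem_powerset.1 hZ, hZc⟩⟩
      · exact ⟨∅, fun h => absurd h hj⟩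
    choose Z hZ using hpig
    set B₁ : ι → Finset β :=
      fun j => (B j).filter (fun b => X₀.filter (fun a => rel i₀ a j b) = Z j) with hB₁
    have hrel : ∀ j, ∀ b ∈ B₁ j, ∀ a ∈ X₀, (rel i₀ a j b ↔ a ∈ Z j) := by
      intro j b hb a ha
      rw [← (Finset.mem_filter.1 hb).2, Finset.mem_filter]
      exact ⟨fun h => ⟨ha, h⟩, fun h => h.2⟩
    have hne : ∀ j ∈ I', i₀ ≠ j := fun j hj h => hi₀ (h ▸ hj)
    have hZt : ∀ j ∈ I', (Z j).card ≤ t := by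
      intro j hj
      by_contra hlt
      obtain ⟨U, hU, hUc⟩ := Finset.exists_subset_card_eq (not_le.1 hlt).le
      obtain ⟨W, hW, hWc⟩ := Finset.exists_subset_card_eq
        (le_trans (Nat.le_add_left t n) (hZ j hj).2)
      refine hno i₀ hi₀I j (hsub j hj) (hne j hj) U (hU.trans ((hZ j hj).1.trans hX₀)) W
        (hW.trans (Finset.filter_subset _ _)) hUc hWc ?_
      intro a ha b hb
      exact (hrel j b (hW hb) a ((hZ j hj).1 (hU ha))).2 (hU ha)
    obtain ⟨B', hB', hB'r⟩ := hn I' B₁ rel hI' hsymm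
      (fun i hi j hj hij U hU W hW => hno i (hsub i hi) j (hsub j hj) hij U
        (hU.trans (Finset.filter_subset _ _)) W (hW.trans (Finset.filter_subset _ _)))
      (fun i hi => le_trans (Nat.le_add_right _ _) (hZ i hi).2)
    have hrest : q ≤ (X₀ \ I'.biUnion Z).card := by
      have h1 : (I'.biUnion Z).card ≤ k * t :=
        (Finset.card_biUnion_le_card_mul _ _ t hZt).trans (by rw [hI'])
      have h2 := Finset.le_card_sdiff (I'.biUnion Z) X₀
      omega
    obtain ⟨Y, hY, hYc⟩ := Finset.exists_subset_card_eq hrest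
    have hY' : ∀ a ∈ Y, ∀ j ∈ I', ∀ b ∈ B' j, ¬ rel i₀ a j b := by
      intro a ha j hj b hb hab
      obtain ⟨h1, h2⟩ := Finset.mem_sdiff.1 (hY ha)
      exact h2 (Finset.mem_biUnion.2 ⟨j, hj, (hrel j b ((hB' j hj).1 hb) a h1).1 hab⟩)
    have hupd : ∀ j ∈ I', Function.update B' i₀ Y j = B' j := fun j hj =>
      Function.update_of_ne (hne j hj).symm _ _
    refine ⟨Function.update B' i₀ Y, ?_, ?_⟩
    · intro i hi
      rcases Finset.mem_insert.1 hi with rfl | hi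
      · rw [Function.update_self]
        exact ⟨(hY.trans Finset.sdiff_subset).trans hX₀, hYc⟩
      · rw [hupd i hi]
        exact ⟨(hB' i hi).1.trans (Finset.filter_subset _ _), (hB' i hi).2⟩
    · intro i hi j hj hij a ha b hb
      rcases Finset.mem_insert.1 hi with rfl | hi' <;>
        rcases Finset.mem_insert.1 hj with rfl | hj'
      · exact absurd rfl hij
      · rw [Function.update_self] at ha
        rw [hupd j hj'] at hb
        exact hY' a ha j hj' b hb
      · rw [Function.update_self] at hb
        rw [hupd i hi'] at ha
        exact fun h => hY' b hb i hi' a ha (hsymm _ _ _ _ h)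
      · rw [hupd i hi'] at ha
        rw [hupd j hj'] at hb
        exact hB'r i hi' j hj' hij a ha b hb

/-- A digraph with bounded in-degree has large independent sets. -/
lemma exists_independent (M k : ℕ) : ∃ n : ℕ, ∀ {ι : Type*} (A : Finset ι) (Z : ι → Finset ι),
    (∀ j ∈ A, (Z j).card < M) → n ≤ A.card →
    ∃ A' ⊆ A, A'.card = k ∧ ∀ i ∈ A', ∀ j ∈ A', i ≠ j → i ∉ Z j := by
  obtain ⟨n, hn⟩ := exists_ramsey (2 * M + 1) k
  refine ⟨n, fun {ι} A Z hZ hA => ?_⟩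
  classical
  rcases hn (SimpleGraph.fromRel (fun i j : ι => i ∈ Z j)) A hA with
    ⟨C, hCA, hC, hadj⟩ | ⟨C, hCA, hC, hadj⟩
  · exfalso
    -- The clique has `(2 * M + 1) * (2 * M)` ordered pairs, but the sets `Z` account for at most `2
    -- * (2 * M + 1) * (M - 1)` of them.
    have hsub : C.offDiag ⊆ (C.biUnion (fun j => (Z j).image (fun i => (i, j)))) ∪
        (C.biUnion (fun i => (Z i).image (fun j => (i, j)))) := by
      rintro ⟨i, j⟩ hij
      obtain ⟨h1, h2, h3⟩ := Finset.mem_offDiag.1 hij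
      have h := hadj i h1 j h2 h3
      rw [SimpleGraph.fromRel_adj] at h
      rw [Finset.mem_union, Finset.mem_biUnion, Finset.mem_biUnion]
      rcases h.2 with h | h
      · exact Or.inl ⟨j, h2, Finset.mem_image.2 ⟨i, h, rfl⟩⟩
      · exact Or.inr ⟨i, h1, Finset.mem_image.2 ⟨j, h, rfl⟩⟩
    have hM : 0 < M := by
      obtain ⟨j, hj⟩ : C.Nonempty := Finset.card_pos.1 (by omega)
      exact lt_of_le_of_lt (Nat.zero_le _) (hZ j (hCA hj))
    have h1 := (Finset.card_le_card hsub).trans (Finset.card_union_le _ _)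
    have h2 : (C.biUnion (fun j => (Z j).image (fun i => (i, j)))).card ≤ C.card * (M - 1) :=
      Finset.card_biUnion_le_card_mul _ _ _ fun j hj =>
        Finset.card_image_le.trans (by have := hZ j (hCA hj); omega)
    have h3 : (C.biUnion (fun i => (Z i).image (fun j => (i, j)))).card ≤ C.card * (M - 1) :=
      Finset.card_biUnion_le_card_mul _ _ _ fun j hj =>
        Finset.card_image_le.trans (by have := hZ j (hCA hj); omega)
    rw [Finset.offDiag_card, hC] at h1
    rw [hC] at h2 h3
    obtain ⟨m, rfl⟩ : ∃ m, M = m + 1 := ⟨M - 1, by omega⟩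
    simp only [Nat.add_sub_cancel] at h2 h3
    have h4 : (2 * (m + 1) + 1) * (2 * (m + 1) + 1) =
        (2 * (m + 1) + 1) * m + (2 * (m + 1) + 1) * m + 3 * (2 * (m + 1) + 1) := by ring
    omega
  · refine ⟨C, hCA, hC, fun i hi j hj hij h => hadj i hi j hj ?_⟩
    rw [SimpleGraph.fromRel_adj]
    exact ⟨hij, Or.inl h⟩

/-! ### Assembling a clean kite -/

lemma pathInterior_eq_drop {x y : V} {p : G.Walk x y} (hp : p.IsPath) (hl : 1 ≤ p.length) :
    pathInterior p = walkVerts (p.drop 1) \ {y} := by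
  ext w
  simp only [pathInterior, Set.mem_sdiff, Set.mem_insert_iff, Set.mem_singleton_iff, not_or]
  rw [mem_walkVerts_drop_iff hl]
  constructor
  · rintro ⟨hw, hx, hy⟩
    obtain ⟨i, rfl, hi⟩ := mem_walkVerts_iff.1 hw
    refine ⟨⟨i, ?_, hi, rfl⟩, hy⟩
    by_contra h
    obtain rfl : i = 0 := by omega
    simp at hx
  · rintro ⟨⟨i, h1, h2, rfl⟩, hy⟩
    refine ⟨p.getVert_mem_support i, fun h => ?_, hy⟩
    have := (hp.getVert_eq_start_iff h2).1 h
    omega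

/-- The interiors of the paths of a theta with at least two paths are legs at its first end. -/
lemma Banana.IsTheta.isLegs {x y : V} {q : ℕ} {T : Banana G x y q} (hT : T.IsTheta) (hq : 2 ≤ q) :
    IsLegs G x Finset.univ (fun b => pathInterior (T.path b))
      (fun b => (T.path b).getVert 1) := by
  have hlen : ∀ b, 2 ≤ (T.path b).length := fun b =>
    IsInducedPath.two_le_length T.ends_ne (T.not_adj hq)
  have h1y : ∀ b, (T.path b).getVert 1 ≠ y := fun b h => by
    have := ((T.isInducedPath b).1.getVert_eq_end_iff (by have := hlen b; omega)).1 h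
    have := hlen b
    omega
  have hint : ∀ b, pathInterior (T.path b) = walkVerts ((T.path b).drop 1) \ {y} := fun b =>
    pathInterior_eq_drop (T.isInducedPath b).1 (by have := hlen b; omega)
  have hadj : ∀ b, G.Adj x ((T.path b).getVert 1) := fun b => by
    simpa using (T.path b).adj_getVert_succ (i := 0) (by have := hlen b; omega)
  exact
    { conn := fun b _ => by
        rw [hint]
        exact (connSet_walkVerts_diff_end ((T.isInducedPath b).1.drop 1) (h1y b)).1
      mem := fun b _ => by
        rw [hint]
        exact ⟨start_mem_walkVerts _, h1y b⟩
      adj := fun b _ => hadj b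
      only := fun b _ w hw hxw => (T.isInducedPath b).eq_of_adj_start hw.1
        ((T.path b).getVert_mem_support 1) hxw (hadj b)
      notMem := fun b _ h => h.2 (by simp)
      anti := fun b _ c _ hbc => hT b c hbc }

lemma Banana.pathInterior_subset {x y : V} {q : ℕ} (T : Banana G x y q) (b : Fin q) :
    pathInterior (T.path b) ⊆ T.verts \ {y} := fun _ hw =>
  ⟨Set.mem_iUnion.2 ⟨b, hw.1⟩, fun h => hw.2 (Or.inr h)⟩

/-- The tailed theta formed by some of the paths of a tailed theta. -/
def TailedTheta.restrict {x z : V} {q m : ℕ} (T : TailedTheta G x z q) (e : Fin m → Fin q)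
    (he : Function.Injective e) : TailedTheta G x z m where
  y := T.y
  x_ne_z := T.x_ne_z
  y_ne_z := T.y_ne_z
  theta := T.theta.restrict e he
  isTheta _ _ hij := T.isTheta _ _ (he.ne hij)
  tail := T.tail
  tail_isInducedPath := T.tail_isInducedPath
  tail_anticomplete := T.tail_anticomplete.mono subset_rfl
    (Set.sdiff_subset_sdiff_left (T.theta.restrict_verts_subset e he))

lemma TailedTheta.restrict_verts_subset {x z : V} {q m : ℕ} (T : TailedTheta G x z q)
    (e : Fin m → Fin q) (he : Function.Injective e) : (T.restrict e he).verts ⊆ T.verts :=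
  Set.union_subset_union_left _ (T.theta.restrict_verts_subset e he)

lemma TailedTheta.start_mem_verts {x z : V} {q : ℕ} (T : TailedTheta G x z q) (hq : 0 < q) :
    x ∈ T.verts := Or.inl (Set.mem_iUnion.2 ⟨⟨0, hq⟩, start_mem_walkVerts _⟩)

lemma TailedTheta.end_mem_verts {x z : V} {q : ℕ} (T : TailedTheta G x z q) : z ∈ T.verts :=
  Or.inr (end_mem_walkVerts _)

/-- A selection of tailed thetas without edges from the paths of one theta to the others is a clean
kite. -/
lemma exists_clean_kite {x z : V} {K Q k q : ℕ} (hq : 0 < q) (T : Fin K → TailedTheta G x z Q)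
    (hT : ∀ i j, i ≠ j → (T i).verts ∩ (T j).verts ⊆ {x, z}) (e : Fin k → Fin K)
    (he : Function.Injective e) (g : Fin k → Fin q → Fin Q) (hg : ∀ i, Function.Injective (g i))
    (hy : ∀ i j, ¬ G.Adj (T (e i)).y (T (e j)).y)
    (htail : ∀ i j a, i ≠ j → ∀ u ∈ pathInterior ((T (e i)).theta.path (g i a)),
      ¬ Touches G u (walkVerts (T (e j)).tail))
    (htheta : ∀ i j a b, i ≠ j → ∀ u ∈ pathInterior ((T (e i)).theta.path (g i a)),
      ¬ Touches G u (pathInterior ((T (e j)).theta.path (g j b)))) :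
    ∃ K : Kite G x z k q, K.IsClean := by
  have hinter : ∀ i j, i ≠ j → ((T (e i)).restrict (g i) (hg i)).verts ∩
      ((T (e j)).restrict (g j) (hg j)).verts = {x, z} := by
    intro i j hij
    refine Set.Subset.antisymm ?_ ?_
    · exact (Set.inter_subset_inter (TailedTheta.restrict_verts_subset _ _ _)
        (TailedTheta.restrict_verts_subset _ _ _)).trans (hT _ _ (he.ne hij))
    · rintro w (rfl | rfl)
      · exact ⟨TailedTheta.start_mem_verts _ hq, TailedTheta.start_mem_verts _ hq⟩
      · exact ⟨TailedTheta.end_mem_verts _, TailedTheta.end_mem_verts _⟩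
  refine ⟨⟨fun i => (T (e i)).restrict (g i) (hg i), hinter⟩, ?_, hy⟩
  rintro i w ⟨hw, hwxy⟩
  obtain ⟨a, ha⟩ := Set.mem_iUnion.1 hw
  set p := (T (e i)).theta.path (g i a) with hp
  have hwp : w ∈ pathInterior p := ⟨ha, hwxy⟩
  have hwT := (T (e i)).theta.pathInterior_subset (g i a) hwp
  -- All neighbors of `w` in the kite lie on its own path, of which it is an inner vertex.
  have hkey : G.neighborSet w ∩ Kite.verts ⟨fun i => (T (e i)).restrict (g i) (hg i), hinter⟩ =
      G.neighborSet w ∩ walkVerts p := by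
    refine Set.Subset.antisymm ?_ ?_
    · rintro u ⟨hwu, hu⟩
      refine ⟨hwu, ?_⟩
      have hwu : G.Adj w u := hwu
      obtain ⟨j, hj⟩ := Set.mem_iUnion.1 hu
      by_cases hux : u = x
      · rw [hux]; exact start_mem_walkVerts p
      by_cases hij : i = j
      · subst hij
        by_cases huy : u = (T (e i)).y
        · rw [huy]; exact end_mem_walkVerts p
        rcases hj with hj | hj
        · obtain ⟨b, hb⟩ := Set.mem_iUnion.1 hj
          by_cases hab : g i a = g i b
          · rw [hp, hab]; exact hb
          · exact absurd hwu (((T (e i)).isTheta _ _ hab).2 w hwp u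
              ⟨hb, by simp [hux, huy]⟩)
        · exact absurd hwu.symm ((T (e i)).tail_anticomplete.2 u ⟨hj, huy⟩ w hwT)
      · exfalso
        rcases hj with hj | hj
        · obtain ⟨b, hb⟩ := Set.mem_iUnion.1 hj
          by_cases huy : u = (T (e j)).y
          -- The end `y` of another theta is the first vertex of its tail.
          · exact htail i j a hij w hwp ⟨u, by rw [huy]; exact start_mem_walkVerts _, hwu⟩
          · exact htheta i j a b hij w hwp ⟨u, ⟨hb, by simp [hux, huy]⟩, hwu⟩
        · exact htail i j a hij w hwp ⟨u, hj, hwu⟩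
    · refine Set.inter_subset_inter_right _ fun u hu => ?_
      exact Set.mem_iUnion.2 ⟨i, Or.inl (Set.mem_iUnion.2 ⟨a, hu⟩)⟩
  rw [hkey]
  exact ((T (e i)).theta.isInducedPath (g i a)).ncard_neighbors hwp

/-- From many tailed thetas with many paths, pairwise meeting only in `x` and `z`, one can
select a clean kite, unless there is a dome with root `x`. -/
theorem exists_clean_kite_or_dome (t s k q : ℕ) (ht : 0 < t) (hq : 0 < q) :
    ∃ K Q : ℕ, ∀ {V : Type*} [Finite V] {G : SimpleGraph V} {x z : V}, IsTidy G t →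
    ∀ T : Fin K → TailedTheta G x z Q,
    (∀ i j, i ≠ j → (T i).verts ∩ (T j).verts ⊆ {x, z}) →
    (∃ K : Kite G x z k q, K.IsClean) ∨ Nonempty (Dome G x s t) := by
  obtain ⟨M, n₁, hM⟩ := exists_dome_of_common_paths t s ht
  obtain ⟨K₁, hK₁⟩ := exists_independent M k
  obtain ⟨K, hK⟩ := exists_stable_bound t K₁
  obtain ⟨n₂, hn₂⟩ := exists_unrelated t q k
  -- There are `2 ^ K` possible traces; a class needs `n₁` and `n₂` paths for the two lemmas and
  -- must be non-empty. The final `2` makes the ends of each theta non-adjacent.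
  refine ⟨K, 2 ^ K * (n₁ + n₂ + 1) + 2, ?_⟩
  intro V _ G x z hG T hT
  classical
  by_cases hdome : Nonempty (Dome G x s t)
  · exact Or.inr hdome
  left
  set X := fun (i : Fin K) b => pathInterior ((T i).theta.path b) with hX
  have hlegs : ∀ i, IsLegs G x Finset.univ (X i) (fun b => ((T i).theta.path b).getVert 1) :=
    fun i => (T i).isTheta.isLegs (by omega)
  have hyx : ∀ i, (T i).y ≠ x := fun i h => (T i).theta.ends_ne h.symm
  have hyT : ∀ i, (T i).y ∈ (T i).verts := fun i => Or.inr (start_mem_walkVerts _)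
  have hXT : ∀ i b, X i b ⊆ (T i).verts := fun i b w hw =>
    Or.inl ((T i).theta.pathInterior_subset b hw).1
  have hxX : ∀ i b, x ∉ X i b := fun i b h => h.2 (by simp)
  have hztail : ∀ i, z ∈ walkVerts (T i).tail \ {(T i).y} := fun i =>
    ⟨end_mem_walkVerts _, fun h => (T i).y_ne_z h.symm⟩
  have hzX : ∀ i b, z ∉ X i b := fun i b h =>
    Set.disjoint_left.1 (T i).tail_anticomplete.1 (hztail i)
      ((T i).theta.pathInterior_subset b h)
  have hzX' : ∀ i b, ∀ a ∈ X i b, ¬ G.Adj a z := fun i b a ha h =>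
    (T i).tail_anticomplete.2 z (hztail i) a ((T i).theta.pathInterior_subset b ha) h.symm
  have hxT : ∀ i, x ∈ (T i).theta.verts \ {(T i).y} := fun i =>
    ⟨Set.mem_iUnion.2 ⟨⟨0, by omega⟩, start_mem_walkVerts _⟩, fun h => hyx i h.symm⟩
  have hxtail : ∀ i, x ∉ walkVerts (T i).tail := fun i h =>
    Set.disjoint_left.1 (T i).tail_anticomplete.1 ⟨h, fun h' => hyx i (Eq.symm h')⟩ (hxT i)
  have hxtail' : ∀ i, ∀ w ∈ walkVerts (T i).tail, ¬ G.Adj x w := by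
    intro i w hw hxw
    by_cases hwy : w = (T i).y
    · exact (T i).theta.not_adj (by omega) (hwy ▸ hxw)
    · exact (T i).tail_anticomplete.2 w ⟨hw, hwy⟩ x (hxT i) hxw.symm
  have hXdisj : ∀ i j b, i ≠ j → Disjoint (X i b) (T j).verts := by
    intro i j b hij
    rw [Set.disjoint_left]
    intro w hw hwj
    rcases hT i j hij ⟨hXT i b hw, hwj⟩ with h | h
    · exact hxX i b (h ▸ hw)
    · exact hzX i b ((Set.mem_singleton_iff.1 h) ▸ hw)
  have hyinj : Function.Injective (fun i => (T i).y) := by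
    intro i j hij
    by_contra hne
    have hij : (T i).y = (T j).y := hij
    rcases hT i j hne ⟨hyT i, hij ▸ hyT j⟩ with h | h
    · exact hyx i h
    · exact (T i).y_ne_z h
  obtain ⟨A₁, -, hA₁c, hA₁⟩ := hK G Finset.univ (fun i => (T i).y) hG.1 hyinj.injOn (by simp)
  -- The trace of a path of the theta `j` records which other tails it touches; `B j` is a large
  -- class of paths with common trace `Z j`.
  set tr : Fin K → Fin (2 ^ K * (n₁ + n₂ + 1) + 2) → Finset (Fin K) := fun j b =>
    Finset.univ.filter (fun i => i ≠ j ∧ ∃ u ∈ X j b, Touches G u (walkVerts (T i).tail)) with htr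
  have hpig : ∀ j, ∃ Z, n₁ + n₂ + 1 ≤ (Finset.univ.filter (fun b => tr j b = Z)).card := by
    intro j
    obtain ⟨Z, -, hZ⟩ := Finset.exists_le_card_fiber_of_mul_le_card_of_maps_to
      (s := Finset.univ) (t := Finset.univ) (f := tr j) (n := n₁ + n₂ + 1)
      (fun _ _ => Finset.mem_univ _) ⟨∅, Finset.mem_univ _⟩ (by simp)
    exact ⟨Z, hZ⟩
  choose Z hZ using hpig
  set B : Fin K → Finset (Fin (2 ^ K * (n₁ + n₂ + 1) + 2)) :=
    fun j => Finset.univ.filter (fun b => tr j b = Z j) with hB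
  have hZmem : ∀ i j, ∀ b ∈ B j,
      (i ∈ Z j ↔ i ≠ j ∧ ∃ u ∈ X j b, Touches G u (walkVerts (T i).tail)) := by
    intro i j b hb
    rw [← (Finset.mem_filter.1 hb).2]
    simp [htr]
  -- The paths in `B j` are legs that touch every tail in `Z j`, and the tails meet only in `z`;
  -- with `M` tails there would be a dome.
  have hZcard : ∀ j, (Z j).card < M := by
    intro j
    by_contra hlt
    have hBn : n₁ ≤ (B j).card := le_trans (by omega) (hZ j)
    obtain ⟨b₀, hb₀⟩ : (B j).Nonempty := Finset.card_pos.1 (lt_of_lt_of_le (by omega) (hZ j))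
    have hne : ∀ i ∈ Z j, i ≠ j := fun i hi => ((hZmem i j b₀ hb₀).1 hi).1
    refine hdome (hM hG ((hlegs j).mono (Finset.subset_univ (B j))) (fun i => (T i).tail) (Z j)
      (fun i _ => (T i).tail_isInducedPath) (fun i _ => hxtail i) (fun i _ => hxtail' i)
      (fun i hi b _ => (hXdisj j i b (hne i hi).symm).mono_right Set.subset_union_right)
      (fun i hi b hb => ((hZmem i j b hb).1 hi).2) ?_ (fun b _ => hzX' j b) (not_lt.1 hlt) hBn)
    intro i hi i' hi' hii w hw hw'
    rcases hT i i' hii ⟨Or.inr hw, Or.inr hw'⟩ with h | h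
    · exact absurd (h ▸ hw) (hxtail i)
    · exact h
  obtain ⟨A₂, hA₂, hA₂c, hA₂Z⟩ := hK₁ A₁ Z (fun j _ => hZcard j) hA₁c.ge
  -- Paths of different thetas are related if an edge joins their interiors; `t` against `t` would
  -- be an induced `K_{t,t}`-minor.
  obtain ⟨B', hB', hB'rel⟩ := hn₂ A₂ B
    (fun i a j b => ∃ u ∈ X i a, ∃ v ∈ X j b, G.Adj u v) hA₂c
    (by
      rintro i a j b ⟨u, hu, v, hv, huv⟩
      exact ⟨v, hv, u, hu, huv.symm⟩)
    (by
      intro i _ j _ hij U _ W _ hU hW hall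
      refine hG.no_bipartite_finset hU hW (X i) (X j)
        (fun b _ => (hlegs i).conn b (Finset.mem_univ _))
        (fun b _ => (hlegs j).conn b (Finset.mem_univ _))
        (fun b _ c _ h => (hlegs i).anti b (Finset.mem_univ _) c (Finset.mem_univ _) h)
        (fun b _ c _ h => (hlegs j).anti b (Finset.mem_univ _) c (Finset.mem_univ _) h)
        (fun b _ c _ => (hXdisj i j b hij).mono_right (hXT j c)) hall)
    (fun i _ => le_trans (by omega) (hZ i))
  obtain ⟨e, he, heA, -⟩ := exists_fin_enum hA₂c
  have hg : ∀ i, ∃ g : Fin q → Fin (2 ^ K * (n₁ + n₂ + 1) + 2), Function.Injective g ∧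
      ∀ a, g a ∈ B' (e i) := fun i => by
    obtain ⟨g, h1, h2, -⟩ := exists_fin_enum (hB' (e i) (heA i)).2
    exact ⟨g, h1, h2⟩
  choose g hginj hgB using hg
  refine exists_clean_kite hq T hT e he g hginj ?_ ?_ ?_
  · exact fun i j => hA₁ _ (hA₂ (heA i)) _ (hA₂ (heA j))
  · intro i j a hij u hu hut
    exact hA₂Z (e j) (heA j) (e i) (heA i) (he.ne hij.symm)
      ((hZmem (e j) (e i) (g i a) ((hB' (e i) (heA i)).1 (hgB i a))).2
        ⟨he.ne hij.symm, u, hu, hut⟩)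
  · rintro i j a b hij u hu ⟨v, hv, huv⟩
    exact hB'rel (e i) (heA i) (e j) (heA j) (he.ne hij) (g i a) (hgB i a) (g j b) (hgB j b)
      ⟨u, hu, v, hv, huv⟩

lemma Banana.inter_verts_subset {V : Type*} {G : SimpleGraph V} {x z : V} {q m n : ℕ}
    (B : Banana G x z q) (e : Fin m → Fin q) (he : Function.Injective e) (g : Fin n → Fin q)
    (hg : Function.Injective g) (heg : ∀ i j, e i ≠ g j) :
    (B.restrict e he).verts ∩ (B.restrict g hg).verts ⊆ {x, z} := by
  rintro w ⟨h1, h2⟩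
  obtain ⟨i, hi⟩ := Set.mem_iUnion.1 h1
  obtain ⟨j, hj⟩ := Set.mem_iUnion.1 h2
  by_contra hw
  exact Set.disjoint_left.1 (B.internally_disjoint _ _ (heg i j)) ⟨hi, hw⟩ ⟨hj, hw⟩

/-- A large dense banana in a tidy graph yields a clean kite or a dome. -/
theorem exists_clean_kite_or_dome_of_banana (k l q s t : ℕ) (hq : 0 < q) (ht : 0 < t) :
    ∃ n : ℕ, 0 < n ∧ ∀ {V : Type*} [Finite V] {G : SimpleGraph V} {x z : V}, IsTidy G t →
      ∀ B : Banana G x z n, B.IsDense l →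
        (∃ K : Kite G x z k q, K.IsClean) ∨ Nonempty (Dome G x s t) := by
  obtain ⟨K, Q, hKQ⟩ := exists_clean_kite_or_dome t s k q ht hq
  obtain ⟨n, hn⟩ := exists_dome_or_tailedTheta t s Q l
  -- `K` groups of `n` paths; the extra path keeps the number positive and is left out by
  -- `castSucc`.
  refine ⟨K * n + 1, Nat.succ_pos _, ?_⟩
  intro V _ G x z hG B hB
  by_cases hdome : Nonempty (Dome G x s t)
  · exact Or.inr hdome
  set e : Fin K → Fin n → Fin (K * n + 1) := fun i b => (finProdFinEquiv (i, b)).castSucc with he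
  have heq : ∀ i j a b, e i a = e j b → i = j ∧ a = b := by
    intro i j a b h
    have := finProdFinEquiv.injective (Fin.castSucc_injective _ h)
    simpa using this
  have hinj : ∀ i, Function.Injective (e i) := fun i a b h => (heq i i a b h).2
  have hT : ∀ i, ∃ T : TailedTheta G x z Q, T.verts ⊆ (B.restrict (e i) (hinj i)).verts := by
    intro i
    refine (hn hG (B.restrict (e i) (hinj i)) le_rfl ?_).resolve_left hdome
    -- Density is inherited, as the group has fewer vertices to offer to a theta.
    rintro ⟨T, h1, h2⟩
    exact hB ⟨T, h1, h2.trans (B.restrict_verts_subset _ _)⟩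
  choose T hT using hT
  refine hKQ hG T fun i j hij => (Set.inter_subset_inter (hT i) (hT j)).trans ?_
  exact B.inter_verts_subset _ _ _ _ fun a b h => hij (heq i j a b h).1

end BananaKite

theorem theorem6p2 :
    ∃ (f : ℕ → ℕ → ℕ → ℕ → ℕ → ℕ) (g : ℕ → ℕ → ℕ),
      ∀ k l q s t : ℕ, 0 < k → 0 < l → 0 < q → 0 < s → 0 < t →
        0 < f k l q s t ∧ 0 < g q t ∧
        ∀ (V : Type*) [Finite V] (G : SimpleGraph V) (x z : V), BananaKite.IsTidy G t →
          ∀ B : BananaKite.Banana G x z (f k l q s t), B.IsRigid → B.IsDense l →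
            (∃ K : BananaKite.Kite G x z k q, K.IsClean) ∨
              Nonempty (BananaKite.Dome G x s (g q t)) := by
  have key : ∀ k l q s t : ℕ, ∃ n : ℕ, 0 < q → 0 < t → 0 < n ∧
      ∀ (V : Type _) [Finite V] (G : SimpleGraph V) (x z : V), BananaKite.IsTidy G t →
        ∀ B : BananaKite.Banana G x z n, B.IsDense l →
          (∃ K : BananaKite.Kite G x z k q, K.IsClean) ∨
            Nonempty (BananaKite.Dome G x s t) := by
    intro k l q s t
    by_cases h : 0 < q ∧ 0 < t
    · obtain ⟨n, hn, hn'⟩ := BananaKite.exists_clean_kite_or_dome_of_banana k l q s t h.1 h.2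
      exact ⟨n, fun _ _ => ⟨hn, fun V _ G x z hG B hB => hn' hG B hB⟩⟩
    · exact ⟨0, fun h1 h2 => absurd ⟨h1, h2⟩ h⟩
  choose f hf using key
  refine ⟨f, fun _ t => t, fun k l q s t _ _ hq _ ht => ⟨(hf k l q s t hq ht).1, ht, ?_⟩⟩
  exact fun V _ G x z hG B _ hB => (hf k l q s t hq ht).2 V G x z hG B hB
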